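/- Let $\mathcal F$ be the complex Fock space of a pair of fermionic fields $b(z)=\sum_{n\in\mathbb Z} b(n)z^{-n}$, $c(z)=\sum_{n\in\mathbb Z} c(n)z^{-n-1}$ with $[b(m),c(n)]_+=\delta_{m,-n}$, $[b(m),b(n)]_+=[c(m),c(n)]_+=0$, generated by a vacuum vector annihilated by $b(n+1)$ and $c(n)$ for $n\ge 0$. For fields $A(z)=\sum_n A_n z^{-n-1}$ and $B(z)=\sum_n B_n z^{-n-1}$, the normally ordered product is $:A(z)B(z):\,=\sum_n\Bigl(\sum_{i<0}A_iB_{n-i-1}+\varepsilon\sum_{i\ge0}B_{n-i-1}A_i\Bigr)z^{-n-1}$, with $\varepsilon=-1$ if $A$ and $B$ are both fermionic and $\varepsilon=1$ otherwise; write $:A^2:\,=\,:AA:$, $:A^3:\,=\,:A(:AA:):$. Put $$j(z)=\,:b(z)c(z):\,=\sum_{n} j_n z^{-n-1},\qquad T(z)=\,:\partial b(z)\,c(z):,\qquad \widetilde W(z)=\tfrac12\bigl(:\partial^2 b(z)\,c(z):-:\partial b(z)\,\partial c(z):\bigr).$$ Let $\mathcal F^l\subset\mathcal F$ $(l\in\mathbb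 Z)$ be the eigenspace of $j_0$ with eigenvalue $l$. For $\alpha\in\mathbb C$ let $\mathcal H_\alpha$ be the Fock space of the Heisenberg algebra $[j_m,j_n]=m\delta_{m,-n}$ with vacuum vector $|\alpha\rangle$, $j_n|\alpha\rangle=\alpha\delta_{n,0}|\alpha\rangle$ for $n\ge0$, and again write $j(z)=\sum_n j_nz^{-n-1}$ for the free bosonic field on $\mathcal H_\alpha$. Then, as fields on $\mathcal F$, $$T(z)=\tfrac12\bigl(:j(z)^2:+\partial j(z)\bigr),\qquad \widetilde W(z)=\tfrac1{12}\bigl(4:j(z)^3:+6:j(z)\,\partial j(z):+\partial^2 j(z)\bigr).$$ Moreover, for every $l\in\mathbb Z$ there is a linear isomorphism $\Phi:\mathcal H_l\to\mathcal F^l$ which intertwines the operators $j_n$, $n\in\mathbb Z$ (the boson–fermion correspondence), and under every such $\Phi$ the fields $T(z)$ and $\widetilde W(z)$ on $\mathcal F^l$ correspond to the fields $\tfrac12(:j(z)^2:+\partial j(z))$ and $\tfrac1{12}(4:j(z)^3:+6:j(z)\,\partial j(z):+\partial^2 j(z))$ on $\mathcal H_l$. -/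

import Mathlib

noncomputable section

namespace BosonFermion

open VertexOperator

/-! ## Fields

A field `A(z) = ∑ₙ Aₙ z^{-n-1}` on a complex vector space `V` is a `VertexOperator ℂ V`;
its modes `Aₙ` are `VertexOperator.ncoeff A n`. -/

section Fields

variable {V : Type*} [AddCommGroup V] [Module ℂ V]

/-- The field `∑ₙ a n z^{-n-1}` with prescribed modes `a n`, where for every vector `v` one has
`a n v = 0` for `n` large. -/
def ofModes (a : ℤ → Module.End ℂ V) (h : ∀ v, ∃ N : ℤ, ∀ n ≥ N, a n v = 0) :
    VertexOperator ℂ V :=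
  VertexOperator.of_coeff (fun n => a (-n - 1)) (fun v => by
    obtain ⟨N, hN⟩ := h v
    refine ⟨-N, fun n hn => ?_⟩
    by_contra hlt
    exact hn (hN _ (by lia)))

@[simp]
theorem ncoeff_ofModes (a : ℤ → Module.End ℂ V) (h : ∀ v, ∃ N : ℤ, ∀ n ≥ N, a n v = 0) (n : ℤ) :
    ncoeff (ofModes a h) n = a n := by
  rw [ofModes, ncoeff_of_coeff]
  congr 1
  ring

/-- The modes of a field annihilate a given vector from some index on. -/
theorem exists_ncoeff_eq_zero (A : VertexOperator ℂ V) (v : V) :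
    ∃ N : ℤ, ∀ n ≥ N, ncoeff A n v = 0 := by
  refine ⟨-((HahnModule.of ℂ).symm (A v)).order, fun n hn => ?_⟩
  exact ncoeff_eq_zero_of_lt_order A n v (by lia)

/-- The derivative `∂A(z)` of a field; its modes are `(∂A)ₙ = -n Aₙ₋₁`. -/
def fieldDeriv (A : VertexOperator ℂ V) : VertexOperator ℂ V :=
  ofModes (fun n => (-n : ℂ) • ncoeff A (n - 1)) (fun v => by
    obtain ⟨N, hN⟩ := exists_ncoeff_eq_zero A v
    exact ⟨N + 1, fun n hn => by simp [hN (n - 1) (by lia)]⟩)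

theorem finite_support_left (A B : VertexOperator ℂ V) (n : ℤ) (v : V) :
    (Function.support fun k : ℕ =>
      ncoeff A (-(k : ℤ) - 1) (ncoeff B (n + k) v)).Finite := by
  obtain ⟨N, hN⟩ := exists_ncoeff_eq_zero B v
  refine (Set.finite_lt_nat (N - n).toNat).subset fun k hk => ?_
  by_contra hlt
  have : N ≤ n + k := by simp only [Set.mem_ofPred_eq] at hlt; lia
  exact hk (by simp [hN _ this])

theorem finite_support_right (A B : VertexOperator ℂ V) (n : ℤ) (v : V) :
    (Function.support fun k : ℕ =>
      ncoeff B (n - k - 1) (ncoeff A k v)).Finite := by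
  obtain ⟨N, hN⟩ := exists_ncoeff_eq_zero A v
  refine (Set.finite_lt_nat N.toNat).subset fun k hk => ?_
  by_contra hlt
  have : N ≤ k := by simp only [Set.mem_ofPred_eq] at hlt; lia
  exact hk (by simp [hN _ this])

/-- The `n`-th mode of the normally ordered product of `A` and `B`,
`∑_{i < 0} Aᵢ Bₙ₋ᵢ₋₁ + ε ∑_{i ≥ 0} Bₙ₋ᵢ₋₁ Aᵢ`, where `ε` is `-1` if both fields are odd and `1`
otherwise. The sums (with `i = -k - 1`, resp. `i = k`) are finite on every vector. -/
def normalMode (ε : ℤˣ) (A B : VertexOperator ℂ V) (n : ℤ) : Module.End ℂ V where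
  toFun v :=
    (∑ᶠ k : ℕ, ncoeff A (-(k : ℤ) - 1) (ncoeff B (n + k) v)) +
      ((ε : ℤ) : ℂ) • ∑ᶠ k : ℕ, ncoeff B (n - k - 1) (ncoeff A k v)
  map_add' u v := by
    simp only [map_add]
    rw [finsum_add_distrib (finite_support_left A B n u) (finite_support_left A B n v),
      finsum_add_distrib (finite_support_right A B n u) (finite_support_right A B n v), smul_add]
    abel
  map_smul' r v := by
    simp only [map_smul, RingHom.id_apply]
    rw [← smul_finsum, ← smul_finsum, smul_add, smul_comm r]

/-- The normally ordered product `:A(z)B(z):`, with the sign `ε` of the exchange of `A` and `B`. -/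
def normalOrder (ε : ℤˣ) (A B : VertexOperator ℂ V) : VertexOperator ℂ V :=
  ofModes (normalMode ε A B) (fun v => by
    obtain ⟨N, hN⟩ := exists_ncoeff_eq_zero A v
    obtain ⟨M, hM⟩ := exists_ncoeff_eq_zero B v
    choose P hP using fun k : ℕ => exists_ncoeff_eq_zero B (ncoeff A k v)
    obtain ⟨Q, hQ⟩ := ((Finset.range N.toNat).image P).bddAbove
    refine ⟨max M (Q + N.toNat + 1), fun n hn => ?_⟩
    have h1 : ∀ k : ℕ, ncoeff A (-(k : ℤ) - 1) (ncoeff B (n + k) v) = 0 := fun k => by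
      rw [hM _ (by have := le_max_left M (Q + N.toNat + 1); lia), map_zero]
    have h2 : ∀ k : ℕ, ncoeff B (n - k - 1) (ncoeff A k v) = 0 := fun k => by
      by_cases hk : k < N.toNat
      · have hQk : P k ≤ Q := hQ (by simpa using ⟨k, by lia, rfl⟩)
        exact hP k _ (by have := le_max_right M (Q + N.toNat + 1); lia)
      · rw [hN k (by lia), map_zero]
    simp [normalMode, h1, h2])

/-- Normally ordered product of two even (bosonic) fields. -/
abbrev nopEven (A B : VertexOperator ℂ V) : VertexOperator ℂ V := normalOrder 1 A B

/-- Normally ordered product of two odd (fermionic) fields. -/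
abbrev nopOdd (A B : VertexOperator ℂ V) : VertexOperator ℂ V := normalOrder (-1) A B

end Fields

/-! ## The Fock space of the `bc` fields

`Fock` is the exterior algebra on anticommuting generators indexed by `ℕ ⊕ ℕ`: the generator
`inl k` stands for the creation operator `b(-k)`, the generator `inr k` for `c(-k-1)`, and the
vacuum is `1`. Creation operators act by left multiplication and annihilation operators by
contraction. -/

/-- The fermionic Fock space `𝓕`. -/
abbrev Fock : Type := ExteriorAlgebra ℂ ((ℕ ⊕ ℕ) →₀ ℂ)

/-- Left multiplication by the `i`-th generator. -/
def create (i : ℕ ⊕ ℕ) : Module.End ℂ Fock :=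
  LinearMap.mulLeft ℂ (ExteriorAlgebra.ι ℂ (Finsupp.single i 1))

/-- The odd derivation dual to the `i`-th generator. -/
def annihilate (i : ℕ ⊕ ℕ) : Module.End ℂ Fock :=
  CliffordAlgebra.contractLeft (Q := (0 : QuadraticForm ℂ ((ℕ ⊕ ℕ) →₀ ℂ))) (Finsupp.lapply i)

theorem finite_annihilate_ne_zero (v : Fock) : {i | annihilate i v ≠ 0}.Finite := by
  induction v using CliffordAlgebra.left_induction with
  | algebraMap r =>
    refine Set.finite_empty.subset fun i hi => hi ?_
    exact CliffordAlgebra.contractLeft_algebraMap _ _ _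
  | add x y hx hy =>
    refine (hx.union hy).subset fun i hi => ?_
    by_contra h
    simp only [Set.mem_union, Set.mem_ofPred_eq, not_or, not_not] at h
    exact hi (by rw [map_add, h.1, h.2, add_zero])
  | ι_mul x m hx =>
    refine (hx.union m.support.finite_toSet).subset fun i hi => ?_
    by_contra h
    simp only [Set.mem_union, Set.mem_ofPred_eq, not_or, not_not, Finset.mem_coe,
      Finsupp.mem_support_iff] at h
    refine hi ((CliffordAlgebra.contractLeft_ι_mul _ _ _).trans ?_)
    have h1 := h.1
    rw [annihilate] at h1
    rw [h1]
    simp [h.2]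

/-- The operators `b(n)`: creation operators for `n ≤ 0`, annihilation operators for `n ≥ 1`. -/
def bMode : ℤ → Module.End ℂ Fock
  | Int.ofNat 0 => create (Sum.inl 0)
  | Int.ofNat (k + 1) => annihilate (Sum.inr k)
  | Int.negSucc k => create (Sum.inl (k + 1))

/-- The operators `c(n)`: creation operators for `n < 0`, annihilation operators for `n ≥ 0`. -/
def cMode : ℤ → Module.End ℂ Fock
  | Int.ofNat k => annihilate (Sum.inl k)
  | Int.negSucc k => create (Sum.inr k)

theorem exists_bMode_eq_zero (v : Fock) : ∃ N : ℤ, ∀ n ≥ N, bMode (n + 1) v = 0 := by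
  obtain ⟨N, hN⟩ := ((finite_annihilate_ne_zero v).preimage
    (Sum.inr_injective (α := ℕ) (β := ℕ)).injOn).bddAbove
  refine ⟨N + 1, fun n hn => ?_⟩
  obtain ⟨k, rfl⟩ := Int.eq_ofNat_of_zero_le (show 0 ≤ n by lia)
  by_contra h
  have : k ≤ N := hN h
  lia

theorem exists_cMode_eq_zero (v : Fock) : ∃ N : ℤ, ∀ n ≥ N, cMode n v = 0 := by
  obtain ⟨N, hN⟩ := ((finite_annihilate_ne_zero v).preimage
    (Sum.inl_injective (α := ℕ) (β := ℕ)).injOn).bddAbove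
  refine ⟨N + 1, fun n hn => ?_⟩
  obtain ⟨k, rfl⟩ := Int.eq_ofNat_of_zero_le (show 0 ≤ n by lia)
  by_contra h
  have : k ≤ N := hN h
  lia

/-- The field `b(z) = ∑ₙ b(n) z^{-n}`; the coefficient of `z^{-n-1}` is `b(n+1)`. -/
def b : VertexOperator ℂ Fock := ofModes (fun n => bMode (n + 1)) exists_bMode_eq_zero

/-- The field `c(z) = ∑ₙ c(n) z^{-n-1}`. -/
def c : VertexOperator ℂ Fock := ofModes cMode exists_cMode_eq_zero

/-- `j(z) = :b(z)c(z):`, with modes `jₙ`. -/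
def j : VertexOperator ℂ Fock := nopOdd b c

/-- `T(z) = :∂b(z)c(z):`. -/
def T : VertexOperator ℂ Fock := nopOdd (fieldDeriv b) c

/-- `W̃(z) = ½(:∂²b(z)c(z): - :∂b(z)∂c(z):)`. -/
def Wtilde : VertexOperator ℂ Fock :=
  (1 / 2 : ℂ) • (nopOdd (fieldDeriv (fieldDeriv b)) c - nopOdd (fieldDeriv b) (fieldDeriv c))

/-- The charge `l` subspace `𝓕ˡ` of `𝓕`: the `l`-eigenspace of `j₀`. -/
def charge (l : ℤ) : Submodule ℂ Fock := Module.End.eigenspace (ncoeff j 0) (l : ℂ)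

/-! ## The Fock spaces of the Heisenberg algebra -/

/-- The underlying space of the Heisenberg Fock space `𝓗_α`: polynomials in the creation operators
`j₋₁, j₋₂, …`, the variable `k` being `j₋ₖ₋₁`; the vacuum vector is `1`. -/
abbrev Heis : Type := MvPolynomial ℕ ℂ

/-- The Heisenberg operators on `𝓗_α`: `j₀ = α`, `jₙ = n ∂/∂j₋ₙ` for `n > 0`, and `jₙ` is
multiplication by the corresponding variable for `n < 0`. -/
def heisMode (α : ℂ) : ℤ → Module.End ℂ Heis
  | Int.ofNat 0 => α • LinearMap.id
  | Int.ofNat (k + 1) => (k + 1 : ℂ) • (MvPolynomial.pderiv k).toLinearMap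
  | Int.negSucc k => LinearMap.mulLeft ℂ (MvPolynomial.X k)

theorem exists_heisMode_eq_zero (α : ℂ) (p : Heis) : ∃ N : ℤ, ∀ n ≥ N, heisMode α n p = 0 := by
  obtain ⟨N, hN⟩ := p.vars.bddAbove
  refine ⟨N + 2, fun n hn => ?_⟩
  obtain ⟨k, rfl⟩ : ∃ k : ℕ, n = Int.ofNat (k + 1) := ⟨(n - 1).toNat, by
    simp only [Int.ofNat_eq_natCast]; lia⟩
  have hk : k ∉ p.vars := fun h => by
    have : k ≤ N := hN h
    simp only [Int.ofNat_eq_natCast] at hn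
    lia
  simp [heisMode, MvPolynomial.pderiv_eq_zero_of_notMem_vars hk]

/-- The free bosonic field `j(z) = ∑ₙ jₙ z^{-n-1}` on `𝓗_α`. -/
def jH (α : ℂ) : VertexOperator ℂ Heis := ofModes (heisMode α) (exists_heisMode_eq_zero α)

/-- A linear isomorphism `𝓗_l ≅ 𝓕ˡ` is a boson-fermion correspondence (in charge `l`) if it is an
isomorphism of representations of the Heisenberg algebra, i.e. intertwines all modes `jₙ`. -/
def IsBosonFermionCorrespondence (l : ℤ) (Φ : Heis ≃ₗ[ℂ] charge l) : Prop :=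
  ∀ (n : ℤ) (x : Heis), (Φ (ncoeff (jH l) n x) : Fock) = ncoeff j n (Φ x : Fock)

end BosonFermion

end

noncomputable section

namespace BosonFermion

open VertexOperator

/-! ## Locally finite sums -/

section FinSum

variable {ι κ M N : Type*} [AddCommGroup M] [AddCommGroup N]

/-! Everything is derived from the anticommutation relations and a cyclic vacuum (`IsFermionFock`);
the exterior algebra serves only to produce such data. Every fermionic field involved has as modes
sums `∑_p w(p) :b_p c_{N-p}:` with polynomial weight `w`. Their commutator with `j_m` is again such
a sum, with weight `w(p-m) - w(p)`, plus a scalar: the anomaly of moving the normal-ordering cut,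
read off from a discrete antiderivative of `w` (`comm_current_bilin`). Hence `j` is a Heisenberg
field, and the fermionic and bosonic expressions for `T`, and then for `W̃`, have the same
commutators with every `j_m`.

The difference `D_n` of the two sides therefore commutes with the current, and it is homogeneous for
the grading operator `T_1`. On the vacuum of charge `l` it gives a singular vector of the same
charge, which must be a multiple of that vacuum. Comparing `T_1`-eigenvalues kills this multiple
except in degree zero, where the two eigenvalues are computed and agree (`eq_zero_of_comm_current`).

This needs the charged vacua to generate the whole space under the current. The key is `:jb: = ∂b`
and `:jc: = -∂c`: applied to a charged vacuum, they express `b_n` and `c_n` recursively through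
creation modes of `j` and the neighbouring vacuum. The polynomial modules generated by the charged
vacua thus span. Each lies in the `j_0`-eigenspace of its charge, and eigenspaces are independent,
so each fills its eigenspace; this is the boson–fermion correspondence. Transport along an arbitrary
intertwiner is formal, since normally ordered products are built from modes. -/

/-- The family `f` has finite support and sum `a`. -/
def HasFinSum (f : ι → M) (a : M) : Prop :=
  (Function.support f).Finite ∧ ∑ᶠ i, f i = a

theorem HasFinSum.unique {f : ι → M} {a a' : M} (h : HasFinSum f a) (h' : HasFinSum f a') :
    a = a' := h.2.symm.trans h'.2

theorem HasFinSum.add {f g : ι → M} {a a' : M} (h : HasFinSum f a) (h' : HasFinSum g a') :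
    HasFinSum (fun i => f i + g i) (a + a') :=
  ⟨(h.1.union h'.1).subset (Function.support_add f g), by
    rw [finsum_add_distrib h.1 h'.1, h.2, h'.2]⟩

theorem HasFinSum.map {f : ι → M} {a : M} (h : HasFinSum f a) (φ : M →+ N) :
    HasFinSum (fun i => φ (f i)) (φ a) :=
  ⟨h.1.subset (Function.support_comp_subset (map_zero φ) f), by rw [← φ.map_finsum h.1, h.2]⟩

theorem hasFinSum_single [DecidableEq ι] (k : ι) (a : M) :
    HasFinSum (fun i => if i = k then a else 0) a :=
  ⟨(Set.finite_singleton k).subset fun i hi => by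
      by_contra h
      exact hi (if_neg h),
    by rw [finsum_eq_single _ k (fun i hi => if_neg hi), if_pos rfl]⟩

theorem HasFinSum.extend {f : κ → M} {a : M} (g : ι → κ) (hg : Function.Injective g)
    (hf : ∀ k ∉ Set.range g, f k = 0) (h : HasFinSum (fun i => f (g i)) a) : HasFinSum f a := by
  have hs : Function.support f ⊆ Set.range g := fun k hk => by
    by_contra h'
    exact hk (hf k h')
  refine ⟨(h.1.image g).subset fun k hk => ?_, ?_⟩
  · obtain ⟨i, rfl⟩ := hs hk
    exact ⟨i, hk, rfl⟩
  · rw [← h.2, ← finsum_mem_range hg, ← finsum_mem_univ f]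
    exact finsum_mem_inter_support_eq f _ _ (by rw [Set.inter_eq_right.2 hs, Set.univ_inter])

theorem HasFinSum.mem {f : ι → M} {a : M} (h : HasFinSum f a) {S : Type*} [SetLike S M]
    [AddSubmonoidClass S M] (s : S) (hf : ∀ i, f i ∈ s) : a ∈ s := by
  rw [← h.2]
  exact finsum_induction (· ∈ s) (zero_mem s) (fun _ _ => add_mem) hf

end FinSum

section LocSum

variable {ι κ V : Type*} [AddCommGroup V] [Module ℂ V]

/-- The family of operators `f` is finite on every vector and has sum `a`. -/
def HasLocSum (f : ι → Module.End ℂ V) (a : Module.End ℂ V) : Prop :=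
  ∀ v, HasFinSum (fun i => f i v) (a v)

variable {f g : ι → Module.End ℂ V} {a a' : Module.End ℂ V}

/-- Operator identities below are mostly proved through this principle: both sides are sums of the
same locally finite family, compared term by term. -/
theorem HasLocSum.unique (h : HasLocSum f a) (h' : HasLocSum f a') : a = a' :=
  LinearMap.ext fun v => (h v).unique (h' v)

theorem HasLocSum.congr (h : HasLocSum f a) (hfg : ∀ i, g i = f i) : HasLocSum g a := by
  rwa [funext hfg]

theorem HasLocSum.add (h : HasLocSum f a) (h' : HasLocSum g a') :
    HasLocSum (fun i => f i + g i) (a + a') := fun v => (h v).add (h' v)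

theorem HasLocSum.smul (h : HasLocSum f a) (r : ℂ) : HasLocSum (fun i => r • f i) (r • a) :=
  fun v => (h v).map (DistribSMul.toAddMonoidHom V r)

theorem HasLocSum.sub (h : HasLocSum f a) (h' : HasLocSum g a') :
    HasLocSum (fun i => f i - g i) (a - a') := by
  have := h.add (h'.smul (-1))
  simpa only [neg_one_smul, ← sub_eq_add_neg] using this

theorem HasLocSum.mul_left (h : HasLocSum f a) (X : Module.End ℂ V) :
    HasLocSum (fun i => X * f i) (X * a) := fun v => (h v).map X.toAddMonoidHom

theorem HasLocSum.mul_right (h : HasLocSum f a) (X : Module.End ℂ V) :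
    HasLocSum (fun i => f i * X) (a * X) := fun v => h (X v)

theorem HasLocSum.comm (h : HasLocSum f a) (X : Module.End ℂ V) :
    HasLocSum (fun i => X * f i - f i * X) (X * a - a * X) :=
  (h.mul_left X).sub (h.mul_right X)

theorem hasLocSum_single [DecidableEq ι] (k : ι) (a : Module.End ℂ V) :
    HasLocSum (fun i => if i = k then a else 0) a := fun v => by
  convert hasFinSum_single k (a v) using 2 with i
  by_cases h : i = k <;> simp [h]

theorem HasLocSum.equiv (h : HasLocSum f a) (e : κ ≃ ι) : HasLocSum (fun k => f (e k)) a :=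
  fun v => by
    refine HasFinSum.extend e.symm e.symm.injective (fun k hk => (hk (e.symm.surjective k)).elim) ?_
    simpa using h v

theorem HasLocSum.shift {f : ℤ → Module.End ℂ V} (h : HasLocSum f a) (m : ℤ) :
    HasLocSum (fun k => f (k + m)) a := h.equiv (Equiv.addRight m)

end LocSum

/-! ### Modes of normally ordered products -/

section NormalMode

variable {V : Type*} [AddCommGroup V] [Module ℂ V]

/-- The `i`-th term of the `n`-th mode of the normally ordered product of `A` and `B`. -/
def normalTerm (ε : ℤˣ) (A B : VertexOperator ℂ V) (n i : ℤ) : Module.End ℂ V :=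
  if i < 0 then ncoeff A i * ncoeff B (n - i - 1)
  else ((ε : ℤ) : ℂ) • (ncoeff B (n - i - 1) * ncoeff A i)

/-- The two half-sums, at `i = -k - 1` and `i = k`, are folded into one sum over `ℤ`, which can then
be shifted and reflected freely. -/
theorem hasLocSum_normalTerm (ε : ℤˣ) (A B : VertexOperator ℂ V) (n : ℤ) :
    HasLocSum (normalTerm ε A B n) (normalMode ε A B n) := fun v => by
  have h1 : HasFinSum (fun i : ℤ => if i < 0 then ncoeff A i (ncoeff B (n - i - 1) v) else 0)
      (∑ᶠ k : ℕ, ncoeff A (-(k : ℤ) - 1) (ncoeff B (n + k) v)) := by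
    refine HasFinSum.extend (fun k : ℕ => -(k : ℤ) - 1) (fun a b h => by simpa using h)
      (fun i hi => if_neg fun h => hi ⟨(-i - 1).toNat, by simp only []; lia⟩) ?_
    have h : ∀ k : ℕ, n - (-(k : ℤ) - 1) - 1 = n + k := fun k => by ring
    have h' : ∀ k : ℕ, -(k : ℤ) - 1 < 0 := fun k => by lia
    simp only [h, h', if_true]
    exact ⟨finite_support_left A B n v, rfl⟩
  have h2 : HasFinSum (fun i : ℤ => if i < 0 then 0 else ncoeff B (n - i - 1) (ncoeff A i v))
      (∑ᶠ k : ℕ, ncoeff B (n - k - 1) (ncoeff A k v)) := by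
    refine HasFinSum.extend (fun k : ℕ => (k : ℤ)) (fun a b h => by simpa using h)
      (fun i hi => if_pos (by by_contra h; exact hi ⟨i.toNat, by simp only []; lia⟩)) ?_
    have h' : ∀ k : ℕ, ¬ (k : ℤ) < 0 := fun k => by lia
    simp only [h', if_false]
    exact ⟨finite_support_right A B n v, rfl⟩
  convert h1.add (h2.map (DistribSMul.toAddMonoidHom V ((ε : ℤ) : ℂ))) using 2 with i
  · simp only [normalTerm]
    split_ifs <;> simp
  · rfl

@[simp]
theorem ncoeff_normalOrder (ε : ℤˣ) (A B : VertexOperator ℂ V) (n : ℤ) :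
    ncoeff (normalOrder ε A B) n = normalMode ε A B n := ncoeff_ofModes _ _ _

@[simp]
theorem ncoeff_fieldDeriv (A : VertexOperator ℂ V) (n : ℤ) :
    ncoeff (fieldDeriv A) n = (-n : ℂ) • ncoeff A (n - 1) := ncoeff_ofModes _ _ _

theorem field_ext {A B : VertexOperator ℂ V} (h : ∀ n, ncoeff A n = ncoeff B n) : A = B := by
  refine HVertexOperator.coeff_inj (funext fun n => ?_)
  rw [coeff_eq_ncoeff, coeff_eq_ncoeff, h]

theorem normalMode_intertwine {W : Type*} [AddCommGroup W] [Module ℂ W] (φ : V →ₗ[ℂ] W) (ε : ℤˣ)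
    {A B : VertexOperator ℂ V} {A' B' : VertexOperator ℂ W}
    (hA : ∀ n x, φ (ncoeff A n x) = ncoeff A' n (φ x))
    (hB : ∀ n x, φ (ncoeff B n x) = ncoeff B' n (φ x)) (n : ℤ) (x : V) :
    φ (normalMode ε A B n x) = normalMode ε A' B' n (φ x) := by
  refine ((hasLocSum_normalTerm ε A B n x).map φ.toAddMonoidHom).unique ?_
  convert hasLocSum_normalTerm ε A' B' n (φ x) using 2 with i
  simp only [normalTerm]
  split_ifs <;> simp [hA, hB]

/-- If `L` rescales the modes of `A` and `B` according to their degrees, then it rescales the modes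
of the normally ordered product. -/
theorem comm_normalMode_of_homogeneous (L : Module.End ℂ V) (ε : ℤˣ) {A B : VertexOperator ℂ V}
    {α β : ℂ} (hA : ∀ n : ℤ, L * ncoeff A n - ncoeff A n * L = (α - n) • ncoeff A n)
    (hB : ∀ n : ℤ, L * ncoeff B n - ncoeff B n * L = (β - n) • ncoeff B n) (n : ℤ) :
    L * normalMode ε A B n - normalMode ε A B n * L = (α + β + 1 - n) • normalMode ε A B n := by
  refine ((hasLocSum_normalTerm ε A B n).comm L).unique
    (((hasLocSum_normalTerm ε A B n).smul _).congr fun i => ?_)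
  -- The commutator with `L` is a derivation, so eigenvalues add; the two mode indices always sum to
  -- `n - 1`, which is why the degree does not depend on `i`.
  have key : ∀ (X Y : Module.End ℂ V) (r s : ℂ), L * X - X * L = r • X → L * Y - Y * L = s • Y →
      L * (X * Y) - X * Y * L = (r + s) • (X * Y) := fun X Y r s hX hY => by
    calc _ = (L * X - X * L) * Y + X * (L * Y - Y * L) := by noncomm_ring
      _ = _ := by rw [hX, hY, add_smul, smul_mul_assoc, mul_smul_comm]
  simp only [normalTerm]
  split_ifs
  · rw [key _ _ _ _ (hA i) (hB (n - i - 1))]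
    congr 1
    push_cast
    ring
  · rw [mul_smul_comm, smul_mul_assoc, ← smul_sub, key _ _ _ _ (hB (n - i - 1)) (hA i), smul_comm]
    congr 1
    push_cast
    ring

theorem comm_fieldDeriv_of_homogeneous (L : Module.End ℂ V) {A : VertexOperator ℂ V}
    {α : ℂ} (hA : ∀ n : ℤ, L * ncoeff A n - ncoeff A n * L = (α - n) • ncoeff A n) (n : ℤ) :
    L * ncoeff (fieldDeriv A) n - ncoeff (fieldDeriv A) n * L =
      (α + 1 - n) • ncoeff (fieldDeriv A) n := by
  rw [ncoeff_fieldDeriv, mul_smul_comm, smul_mul_assoc, ← smul_sub, hA, smul_comm]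
  congr 1
  push_cast
  ring

end NormalMode

/-! ## Anticommutation relations -/

theorem create_mul_create (i k : ℕ ⊕ ℕ) : create i * create k = -(create k * create i) := by
  refine LinearMap.ext fun v => ?_
  have h : ExteriorAlgebra.ι ℂ (Finsupp.single i (1 : ℂ)) *
      ExteriorAlgebra.ι ℂ (Finsupp.single k (1 : ℂ)) =
      -(ExteriorAlgebra.ι ℂ (Finsupp.single k 1) * ExteriorAlgebra.ι ℂ (Finsupp.single i 1)) :=
    eq_neg_of_add_eq_zero_left (ExteriorAlgebra.ι_add_mul_swap _ _)
  change ExteriorAlgebra.ι ℂ _ * (ExteriorAlgebra.ι ℂ _ * v) =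
    -(ExteriorAlgebra.ι ℂ _ * (ExteriorAlgebra.ι ℂ _ * v))
  rw [← mul_assoc, h, neg_mul, mul_assoc]

theorem annihilate_mul_annihilate (i k : ℕ ⊕ ℕ) :
    annihilate i * annihilate k = -(annihilate k * annihilate i) := by
  refine LinearMap.ext fun v => ?_
  exact CliffordAlgebra.contractLeft_comm (Q := (0 : QuadraticForm ℂ ((ℕ ⊕ ℕ) →₀ ℂ))) _ _ _

/-- Contraction with a coordinate functional is an odd derivation of the exterior algebra. -/
theorem annihilate_mul_create (i k : ℕ ⊕ ℕ) :
    annihilate i * create k = (if i = k then 1 else 0) - create k * annihilate i := by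
  refine LinearMap.ext fun v => ?_
  refine (CliffordAlgebra.contractLeft_ι_mul (Q := (0 : QuadraticForm ℂ ((ℕ ⊕ ℕ) →₀ ℂ))) _ _ _).trans ?_
  by_cases h : i = k
  · subst h
    simp [create, annihilate]
  · simp [create, annihilate, h]

theorem ncoeff_b (n : ℤ) : ncoeff b n = bMode (n + 1) := ncoeff_ofModes _ _ _

theorem ncoeff_c (n : ℤ) : ncoeff c n = cMode n := ncoeff_ofModes _ _ _

/-- The shift `b_n = b(n+1)` puts the creation/annihilation boundary of `b` at index `0`, the same
place as for `c`. -/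
theorem ncoeff_b_natCast (k : ℕ) : ncoeff b k = annihilate (Sum.inr k) := by
  rw [ncoeff_b]
  rfl

theorem ncoeff_b_negSucc (k : ℕ) : ncoeff b (Int.negSucc k) = create (Sum.inl k) := by
  rw [ncoeff_b]
  cases k with
  | zero => rfl
  | succ k =>
    have : Int.negSucc (k + 1) + 1 = Int.negSucc k := by lia
    rw [this]
    rfl

theorem ncoeff_c_natCast (k : ℕ) : ncoeff c k = annihilate (Sum.inl k) := by
  rw [ncoeff_c]
  rfl

theorem ncoeff_c_negSucc (k : ℕ) : ncoeff c (Int.negSucc k) = create (Sum.inr k) := by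
  rw [ncoeff_c]
  rfl

theorem b_mul_b (m n : ℤ) : ncoeff b m * ncoeff b n = -(ncoeff b n * ncoeff b m) := by
  obtain m | m := m <;> obtain n | n := n <;>
    simp only [Int.ofNat_eq_natCast, ncoeff_b_natCast, ncoeff_b_negSucc]
  · exact annihilate_mul_annihilate _ _
  · simp [annihilate_mul_create]
  · simp [annihilate_mul_create]
  · exact create_mul_create _ _

theorem c_mul_c (m n : ℤ) : ncoeff c m * ncoeff c n = -(ncoeff c n * ncoeff c m) := by
  obtain m | m := m <;> obtain n | n := n <;>
    simp only [Int.ofNat_eq_natCast, ncoeff_c_natCast, ncoeff_c_negSucc]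
  · exact annihilate_mul_annihilate _ _
  · simp [annihilate_mul_create]
  · simp [annihilate_mul_create]
  · exact create_mul_create _ _

theorem b_mul_c (m n : ℤ) :
    ncoeff b m * ncoeff c n = (if m + n + 1 = 0 then 1 else 0) - ncoeff c n * ncoeff b m := by
  obtain m | m := m <;> obtain n | n := n <;>
    simp only [Int.ofNat_eq_natCast, ncoeff_b_natCast, ncoeff_b_negSucc, ncoeff_c_natCast,
      ncoeff_c_negSucc]
  · rw [if_neg (by lia), annihilate_mul_annihilate, zero_sub]
  · rw [annihilate_mul_create]
    simp only [Sum.inr.injEq]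
    congr 2
    rw [eq_iff_iff]
    lia
  · rw [annihilate_mul_create]
    simp only [Sum.inl.injEq]
    rw [sub_sub_eq_add_sub, eq_sub_iff_add_eq, add_comm, add_left_inj]
    congr 1
    rw [eq_iff_iff]
    lia
  · rw [if_neg (by lia), create_mul_create, zero_sub]

theorem b_vacuum {n : ℤ} (hn : 0 ≤ n) : ncoeff b n 1 = 0 := by
  obtain ⟨k, rfl⟩ := Int.eq_ofNat_of_zero_le hn
  rw [ncoeff_b_natCast]
  exact CliffordAlgebra.contractLeft_one (Q := (0 : QuadraticForm ℂ ((ℕ ⊕ ℕ) →₀ ℂ))) _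

theorem c_vacuum {n : ℤ} (hn : 0 ≤ n) : ncoeff c n 1 = 0 := by
  obtain ⟨k, rfl⟩ := Int.eq_ofNat_of_zero_le hn
  rw [ncoeff_c_natCast]
  exact CliffordAlgebra.contractLeft_one (Q := (0 : QuadraticForm ℂ ((ℕ ⊕ ℕ) →₀ ℂ))) _

/-- The Fock space is generated from the vacuum by the modes of `b` and `c`. -/
theorem submodule_eq_top {S : Submodule ℂ Fock} (h1 : 1 ∈ S)
    (hb : ∀ (n : ℤ), ∀ v ∈ S, ncoeff b n v ∈ S) (hc : ∀ (n : ℤ), ∀ v ∈ S, ncoeff c n v ∈ S) :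
    S = ⊤ := by
  refine eq_top_iff.2 fun v _ => ?_
  induction v using CliffordAlgebra.left_induction with
  | algebraMap r =>
    rw [Algebra.algebraMap_eq_smul_one]
    exact S.smul_mem r h1
  | add x y hx hy => exact S.add_mem (hx trivial) (hy trivial)
  | ι_mul x m hx =>
    have hx := hx trivial
    have key : ∀ i, create i x ∈ S := fun i => by
      obtain k | k := i
      · rw [← ncoeff_b_negSucc]
        exact hb _ _ hx
      · rw [← ncoeff_c_negSucc]
        exact hc _ _ hx
    induction m using Finsupp.induction_linear with
    | zero => simp
    | add f g hf hg =>
      rw [map_add, add_mul]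
      exact S.add_mem (hf trivial) (hg trivial)
    | single i r =>
      have : CliffordAlgebra.ι (0 : QuadraticForm ℂ ((ℕ ⊕ ℕ) →₀ ℂ)) (Finsupp.single i r) * x =
          r • create i x := by
        rw [show Finsupp.single i r = r • Finsupp.single i (1 : ℂ) by simp, map_smul]
        exact smul_mul_assoc _ _ _
      rw [this]
      exact S.smul_mem r (key i)

/-- The fields `β`, `γ` satisfy the anticommutation relations of `b`, `c`, and `Ω` is a nonzero cyclic
vector annihilated by the nonnegative modes. -/
structure IsFermionFock {V : Type*} [AddCommGroup V] [Module ℂ V] (β γ : VertexOperator ℂ V)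
    (Ω : V) : Prop where
  b_mul_b (m n : ℤ) : ncoeff β m * ncoeff β n = -(ncoeff β n * ncoeff β m)
  c_mul_c (m n : ℤ) : ncoeff γ m * ncoeff γ n = -(ncoeff γ n * ncoeff γ m)
  b_mul_c (m n : ℤ) :
    ncoeff β m * ncoeff γ n = (if m + n + 1 = 0 then 1 else 0) - ncoeff γ n * ncoeff β m
  b_vacuum {n : ℤ} (hn : 0 ≤ n) : ncoeff β n Ω = 0
  c_vacuum {n : ℤ} (hn : 0 ≤ n) : ncoeff γ n Ω = 0
  vacuum_ne_zero : Ω ≠ 0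
  submodule_eq_top {S : Submodule ℂ V} (h1 : Ω ∈ S) (hb : ∀ (n : ℤ), ∀ v ∈ S, ncoeff β n v ∈ S)
    (hc : ∀ (n : ℤ), ∀ v ∈ S, ncoeff γ n v ∈ S) : S = ⊤

theorem isFermionFock_b_c : IsFermionFock b c (1 : Fock) :=
  ⟨b_mul_b, c_mul_c, b_mul_c, b_vacuum, c_vacuum, one_ne_zero, submodule_eq_top⟩

theorem IsFermionFock.c_mul_b {V : Type*} [AddCommGroup V] [Module ℂ V] {β γ : VertexOperator ℂ V}
    {Ω : V} (H : IsFermionFock β γ Ω) (m n : ℤ) :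
    ncoeff γ m * ncoeff β n = (if m + n + 1 = 0 then 1 else 0) - ncoeff β n * ncoeff γ m := by
  rw [H.b_mul_c, add_comm n m, sub_sub_cancel]

/-! ## Weighted bilinear sums -/

section Bilin

variable {V : Type*} [AddCommGroup V] [Module ℂ V] {β γ : VertexOperator ℂ V} {Ω : V}

/-- The field with modes `w n • Aₙ`. -/
def weighted (w : ℤ → ℂ) (A : VertexOperator ℂ V) :
    VertexOperator ℂ V :=
  ofModes (fun n => w n • ncoeff A n) fun v => by
    obtain ⟨N, hN⟩ := exists_ncoeff_eq_zero A v
    exact ⟨N, fun n hn => by simp [hN n hn]⟩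

/-- The `p`-th term of the weighted sum of the `b_p c_{N-p}`, the product being reordered for
`p ≥ M`. -/
def cutTerm (β γ : VertexOperator ℂ V) (w : ℤ → ℂ) (N M p : ℤ) : Module.End ℂ V :=
  if p < M then w p • (ncoeff β p * ncoeff γ (N - p))
  else -(w p • (ncoeff γ (N - p) * ncoeff β p))

/-- The operator `∑_p w(p) :b_p c_{N-p}:`. -/
def bilin (β γ : VertexOperator ℂ V) (w : ℤ → ℂ) (N : ℤ) : Module.End ℂ V := normalMode (-1) (weighted w β) γ (N + 1)

theorem hasLocSum_bilin (β γ : VertexOperator ℂ V) (w : ℤ → ℂ) (N : ℤ) : HasLocSum (cutTerm β γ w N 0) (bilin β γ w N) := by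
  refine (hasLocSum_normalTerm (-1) (weighted w β) γ (N + 1)).congr fun p => ?_
  have : N + 1 - p - 1 = N - p := by ring
  simp only [normalTerm, cutTerm, weighted, ncoeff_ofModes, this]
  split_ifs <;> simp

/-- Only the term `p = M` is reordered, and its anticommutator is nonzero exactly when the indices
`M` and `N - M` sum to `-1`. -/
theorem IsFermionFock.cutTerm_succ (H : IsFermionFock β γ Ω) (w : ℤ → ℂ) (N M p : ℤ) :
    cutTerm β γ w N (M + 1) p = cutTerm β γ w N M p +
      if p = M then (if N + 1 = 0 then w M else 0) • 1 else 0 := by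
  unfold cutTerm
  rcases lt_trichotomy p M with h | rfl | h
  · rw [if_pos (by lia), if_pos h, if_neg (by lia), add_zero]
  · rw [if_pos (by lia), if_neg (by lia), if_pos rfl, H.b_mul_c]
    simp only [show p + (N - p) + 1 = N + 1 by ring]
    split_ifs <;> simp [sub_eq_add_neg, add_comm]
  · rw [if_neg (by lia), if_neg (by lia), if_neg (by lia), add_zero]

/-- The normal-ordering anomaly: moving the cut from `0` to `M` accumulates the values of `w` in
between, with sign, and `g` is the discrete antiderivative of `w` vanishing at `0`. The central
terms below come from here. -/
theorem IsFermionFock.hasLocSum_cutTerm (H : IsFermionFock β γ Ω) {w g : ℤ → ℂ} (h0 : g 0 = 0) (hg : ∀ k, g (k + 1) = g k + w k)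
    (N M : ℤ) :
    HasLocSum (cutTerm β γ w N M) (bilin β γ w N + (if N + 1 = 0 then g M else 0) • 1) := by
  induction M using Int.induction_on with
  | zero => simpa [h0] using hasLocSum_bilin β γ w N
  | succ k ih =>
    have h := (ih.add (hasLocSum_single (k : ℤ) ((if N + 1 = 0 then w k else 0) • 1))).congr
      (H.cutTerm_succ w N k)
    convert h using 1
    rw [add_assoc, ← add_smul, hg]
    congr 2
    split_ifs <;> simp
  | pred k ih =>
    have h := (ih.sub (hasLocSum_single (-(k : ℤ) - 1)
      ((if N + 1 = 0 then w (-(k : ℤ) - 1) else 0) • 1))).congr (g := cutTerm β γ w N (-(k : ℤ) - 1))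
      (fun p => by
        have := H.cutTerm_succ w N (-(k : ℤ) - 1) p
        rw [sub_add_cancel] at this
        rw [this, add_sub_cancel_right])
    convert h using 1
    have := hg (-(k : ℤ) - 1)
    rw [sub_add_cancel] at this
    rw [this]
    split_ifs
    · rw [add_smul]
      abel
    · simp

theorem bilin_congr (β γ : VertexOperator ℂ V) {w w' : ℤ → ℂ} {N N' : ℤ} (hw : ∀ p, w p = w' p) (hN : N = N') :
    bilin β γ w N = bilin β γ w' N' := by
  rw [funext hw, hN]

theorem bilin_add (β γ : VertexOperator ℂ V) (w w' : ℤ → ℂ) (N : ℤ) :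
    bilin β γ (fun p => w p + w' p) N = bilin β γ w N + bilin β γ w' N := by
  refine (hasLocSum_bilin β γ _ N).unique (((hasLocSum_bilin β γ w N).add (hasLocSum_bilin β γ w' N)).congr
    fun p => ?_)
  unfold cutTerm
  split_ifs <;> simp only [add_smul, neg_add]

theorem bilin_smul (β γ : VertexOperator ℂ V) (r : ℂ) (w : ℤ → ℂ) (N : ℤ) :
    bilin β γ (fun p => r * w p) N = r • bilin β γ w N := by
  refine (hasLocSum_bilin β γ _ N).unique (((hasLocSum_bilin β γ w N).smul r).congr fun p => ?_)
  unfold cutTerm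
  split_ifs <;> simp only [mul_smul, smul_neg]

/-- Only the term whose `c`-factor pairs with `b_k` survives, namely `p = N + k + 1`; the ordering
of a term affects it by a scalar at most, which commutes with everything. -/
theorem IsFermionFock.comm_bilin_b (H : IsFermionFock β γ Ω) (w : ℤ → ℂ) (N k : ℤ) :
    bilin β γ w N * ncoeff β k - ncoeff β k * bilin β γ w N = w (N + k + 1) • ncoeff β (N + k + 1) := by
  have h := (hasLocSum_bilin β γ w N).comm (ncoeff β k)
  rw [← neg_sub, neg_eq_iff_eq_neg]
  refine h.unique ((hasLocSum_single (N + k + 1) (-(w (N + k + 1) • ncoeff β (N + k + 1)))).congr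
    fun p => ?_)
  have e1 : ncoeff β k * (ncoeff β p * ncoeff γ (N - p)) -
      ncoeff β p * ncoeff γ (N - p) * ncoeff β k =
      -((if p = N + k + 1 then (1 : ℂ) else 0) • ncoeff β p) := by
    rw [mul_assoc, H.c_mul_b, ← mul_assoc, H.b_mul_b k p]
    by_cases h : p = N + k + 1
    · rw [if_pos h, if_pos (by lia), one_smul]
      noncomm_ring
    · rw [if_neg h, if_neg (by lia), zero_smul]
      noncomm_ring
  have e2 : ncoeff β k * (ncoeff γ (N - p) * ncoeff β p) -
      ncoeff γ (N - p) * ncoeff β p * ncoeff β k =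
      (if p = N + k + 1 then (1 : ℂ) else 0) • ncoeff β p := by
    rw [mul_assoc, H.b_mul_b p k, ← mul_assoc, H.b_mul_c]
    by_cases h : p = N + k + 1
    · rw [if_pos h, if_pos (by lia), one_smul]
      noncomm_ring
    · rw [if_neg h, if_neg (by lia), zero_smul]
      noncomm_ring
  unfold cutTerm
  by_cases hp : p < 0
  · rw [if_pos hp, mul_smul_comm, smul_mul_assoc, ← smul_sub, e1]
    split_ifs with h
    · rw [h]
      simp
    · simp
  · rw [if_neg hp, mul_neg, neg_mul, mul_smul_comm, smul_mul_assoc, ← neg_sub', ← smul_sub, e2]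
    split_ifs with h
    · rw [h]
      simp
    · simp

/-- Here the surviving term is the one whose `b`-factor pairs with `c_k`, so `p = -k - 1`. -/
theorem IsFermionFock.comm_bilin_c (H : IsFermionFock β γ Ω) (w : ℤ → ℂ) (N k : ℤ) :
    bilin β γ w N * ncoeff γ k - ncoeff γ k * bilin β γ w N = -(w (-k - 1) • ncoeff γ (N + k + 1)) := by
  have h := (hasLocSum_bilin β γ w N).comm (ncoeff γ k)
  rw [← neg_sub, neg_inj]
  refine h.unique ((hasLocSum_single (-k - 1) (w (-k - 1) • ncoeff γ (N + k + 1))).congr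
    fun p => ?_)
  have e1 : ncoeff γ k * (ncoeff β p * ncoeff γ (N - p)) -
      ncoeff β p * ncoeff γ (N - p) * ncoeff γ k =
      (if p = -k - 1 then (1 : ℂ) else 0) • ncoeff γ (N - p) := by
    rw [mul_assoc, H.c_mul_c _ k, ← mul_assoc, H.c_mul_b]
    by_cases h : p = -k - 1
    · rw [if_pos h, if_pos (by lia), one_smul]
      noncomm_ring
    · rw [if_neg h, if_neg (by lia), zero_smul]
      noncomm_ring
  have e2 : ncoeff γ k * (ncoeff γ (N - p) * ncoeff β p) -
      ncoeff γ (N - p) * ncoeff β p * ncoeff γ k =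
      -((if p = -k - 1 then (1 : ℂ) else 0) • ncoeff γ (N - p)) := by
    rw [mul_assoc, H.b_mul_c, ← mul_assoc, H.c_mul_c k]
    by_cases h : p = -k - 1
    · rw [if_pos h, if_pos (by lia), one_smul]
      noncomm_ring
    · rw [if_neg h, if_neg (by lia), zero_smul]
      noncomm_ring
  have e3 : N - (-k - 1) = N + k + 1 := by ring
  unfold cutTerm
  by_cases hp : p < 0
  · rw [if_pos hp, mul_smul_comm, smul_mul_assoc, ← smul_sub, e1]
    split_ifs with h
    · rw [h, e3]
      simp
    · simp
  · rw [if_neg hp, mul_neg, neg_mul, mul_smul_comm, smul_mul_assoc, ← neg_sub', ← smul_sub, e2]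
    split_ifs with h
    · rw [h, e3]
      simp
    · simp

end Bilin

/-! ### Commutators of the bosonic fields with the current -/

section Heisenberg

variable {V : Type*} [AddCommGroup V] [Module ℂ V]

theorem comm_mul (X Y Z : Module.End ℂ V) :
    X * (Y * Z) - Y * Z * X = (X * Y - Y * X) * Z + Y * (X * Z - Z * X) := by
  noncomm_ring

/-- The modes of `J` satisfy the relations of the Heisenberg algebra. -/
def IsHeisenberg (J : VertexOperator ℂ V) : Prop :=
  ∀ m n : ℤ, ncoeff J m * ncoeff J n - ncoeff J n * ncoeff J m =
    (if n = -m then (m : ℂ) else 0) • (1 : Module.End ℂ V)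

variable {J B : VertexOperator ℂ V}

/-- By the Leibniz rule `J_m` meets the factor `J` only at `i = -m` and the factor `B` only at `i =
n - k - 1`. Both commutators are scalar, so the ordering of the term does not matter. -/
theorem IsHeisenberg.comm_normalMode_of_scalar (hJ : IsHeisenberg J) {m k : ℤ} {s : ℂ}
    (hB : ∀ n : ℤ, ncoeff J m * ncoeff B n - ncoeff B n * ncoeff J m =
      (if n = k then s else 0) • (1 : Module.End ℂ V)) (n : ℤ) :
    ncoeff J m * normalMode 1 J B n - normalMode 1 J B n * ncoeff J m =
      (m : ℂ) • ncoeff B (n + m - 1) + s • ncoeff J (n - k - 1) := by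
  refine ((hasLocSum_normalTerm 1 J B n).comm (ncoeff J m)).unique
    (((hasLocSum_single (-m) ((m : ℂ) • ncoeff B (n + m - 1))).add
      (hasLocSum_single (n - k - 1) (s • ncoeff J (n - k - 1)))).congr fun i => ?_)
  have e : ∀ r : ℂ, (if i = -m then r else 0) • ncoeff B (n - i - 1) =
      if i = -m then r • ncoeff B (n + m - 1) else 0 := fun r => by
    split_ifs with h
    · rw [h, sub_neg_eq_add]
    · exact zero_smul _ _
  have e' : ∀ r : ℂ, (if n - i - 1 = k then r else 0) • ncoeff J i =
      if i = n - k - 1 then r • ncoeff J (n - k - 1) else 0 := fun r => by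
    by_cases h : i = n - k - 1
    · rw [if_pos (by lia), if_pos h, h]
    · rw [if_neg (by lia), if_neg h, zero_smul]
  simp only [normalTerm, Units.val_one, Int.cast_one, one_smul]
  by_cases hi : i < 0
  · simp only [if_pos hi]
    rw [comm_mul, hJ, hB, smul_one_mul, mul_smul_one, e, e']
  · simp only [if_neg hi]
    rw [comm_mul, hJ, hB, smul_one_mul, mul_smul_one, e, e', add_comm]

theorem IsHeisenberg.comm_normalMode_of_field (hJ : IsHeisenberg J) {m : ℤ} {r : ℂ} {d : ℤ}
    {C : VertexOperator ℂ V}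
    (hB : ∀ n : ℤ, ncoeff J m * ncoeff B n - ncoeff B n * ncoeff J m = r • ncoeff C (n + d))
    (n : ℤ) :
    ncoeff J m * normalMode 1 J B n - normalMode 1 J B n * ncoeff J m =
      (m : ℂ) • ncoeff B (n + m - 1) + r • normalMode 1 J C (n + d) := by
  refine ((hasLocSum_normalTerm 1 J B n).comm (ncoeff J m)).unique
    (((hasLocSum_single (-m) ((m : ℂ) • ncoeff B (n + m - 1))).add
      ((hasLocSum_normalTerm 1 J C (n + d)).smul r)).congr fun i => ?_)
  have e : ∀ r : ℂ, (if i = -m then r else 0) • ncoeff B (n - i - 1) =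
      if i = -m then r • ncoeff B (n + m - 1) else 0 := fun r => by
    split_ifs with h
    · rw [h, sub_neg_eq_add]
    · exact zero_smul _ _
  have hn : n - i - 1 + d = n + d - i - 1 := by ring
  simp only [normalTerm, Units.val_one, Int.cast_one, one_smul]
  by_cases hi : i < 0
  · simp only [if_pos hi]
    rw [comm_mul, hJ, hB, smul_one_mul, e, mul_smul_comm, hn]
  · simp only [if_neg hi]
    rw [comm_mul, hJ, hB, mul_smul_one, e, smul_mul_assoc, hn, add_comm]

theorem IsHeisenberg.comm_sq (hJ : IsHeisenberg J) (m n : ℤ) :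
    ncoeff J m * ncoeff (nopEven J J) n - ncoeff (nopEven J J) n * ncoeff J m =
      (2 * m : ℂ) • ncoeff J (n + m - 1) := by
  rw [ncoeff_normalOrder, hJ.comm_normalMode_of_scalar (hJ m), sub_neg_eq_add, ← add_smul, two_mul]

theorem IsHeisenberg.comm_deriv (hJ : IsHeisenberg J) (m n : ℤ) :
    ncoeff J m * ncoeff (fieldDeriv J) n - ncoeff (fieldDeriv J) n * ncoeff J m =
      (if n = 1 - m then (m * (m - 1) : ℂ) else 0) • (1 : Module.End ℂ V) := by
  rw [ncoeff_fieldDeriv, mul_smul_comm, smul_mul_assoc, ← smul_sub, hJ, smul_smul]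
  congr 1
  by_cases h : n = 1 - m
  · rw [if_pos h, if_pos (by lia), h]
    push_cast
    ring
  · rw [if_neg h, if_neg (by lia), mul_zero]

theorem IsHeisenberg.comm_deriv_deriv (hJ : IsHeisenberg J) (m n : ℤ) :
    ncoeff J m * ncoeff (fieldDeriv (fieldDeriv J)) n -
        ncoeff (fieldDeriv (fieldDeriv J)) n * ncoeff J m =
      (if n = 2 - m then (m * (m - 1) * (m - 2) : ℂ) else 0) • (1 : Module.End ℂ V) := by
  rw [ncoeff_fieldDeriv, mul_smul_comm, smul_mul_assoc, ← smul_sub, hJ.comm_deriv, smul_smul]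
  congr 1
  by_cases h : n = 2 - m
  · rw [if_pos h, if_pos (by lia), h]
    push_cast
    ring
  · rw [if_neg h, if_neg (by lia), mul_zero]

theorem IsHeisenberg.comm_cube (hJ : IsHeisenberg J) (m n : ℤ) :
    ncoeff J m * ncoeff (nopEven J (nopEven J J)) n -
        ncoeff (nopEven J (nopEven J J)) n * ncoeff J m =
      (3 * m : ℂ) • ncoeff (nopEven J J) (n + m - 1) := by
  rw [ncoeff_normalOrder 1 J (nopEven J J),
    -- `comm_sq` supplies the inner commutator; together with the contraction of the outer factor it
    -- gives `m + 2m = 3m`.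
    hJ.comm_normalMode_of_field (r := 2 * m) (d := m - 1) (C := J) (fun k => by
      rw [hJ.comm_sq, add_sub_assoc]), ncoeff_normalOrder, ← add_sub_assoc, ← add_smul]
  congr 1
  ring

theorem IsHeisenberg.comm_mul_deriv (hJ : IsHeisenberg J) (m n : ℤ) :
    ncoeff J m * ncoeff (nopEven J (fieldDeriv J)) n -
        ncoeff (nopEven J (fieldDeriv J)) n * ncoeff J m =
      (m : ℂ) • ncoeff (fieldDeriv J) (n + m - 1) +
        (m * (m - 1) : ℂ) • ncoeff J (n + m - 2) := by
  rw [ncoeff_normalOrder, hJ.comm_normalMode_of_scalar (hJ.comm_deriv m),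
    show n - (1 - m) - 1 = n + m - 2 by ring]

/-- The field `½(:J²: + ∂J)`. -/
def bosonStress (J : VertexOperator ℂ V) : VertexOperator ℂ V :=
  (1 / 2 : ℂ) • (nopEven J J + fieldDeriv J)

/-- The field `(4:J³: + 6:J∂J: + ∂²J)/12`. -/
def bosonCubic (J : VertexOperator ℂ V) : VertexOperator ℂ V :=
  (1 / 12 : ℂ) • ((4 : ℂ) • nopEven J (nopEven J J) + (6 : ℂ) • nopEven J (fieldDeriv J) +
    fieldDeriv (fieldDeriv J))

theorem ncoeff_bosonStress (J : VertexOperator ℂ V) (n : ℤ) :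
    ncoeff (bosonStress J) n =
      (1 / 2 : ℂ) • (ncoeff (nopEven J J) n + ncoeff (fieldDeriv J) n) := by
  simp only [bosonStress, map_smul, map_add, Pi.smul_apply, Pi.add_apply]

theorem ncoeff_bosonCubic (J : VertexOperator ℂ V) (n : ℤ) :
    ncoeff (bosonCubic J) n =
      (1 / 12 : ℂ) • ((4 : ℂ) • ncoeff (nopEven J (nopEven J J)) n +
        (6 : ℂ) • ncoeff (nopEven J (fieldDeriv J)) n + ncoeff (fieldDeriv (fieldDeriv J)) n) := by
  simp only [bosonCubic, map_smul, map_add, Pi.smul_apply, Pi.add_apply]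

theorem IsHeisenberg.comm_bosonStress (hJ : IsHeisenberg J) (m n : ℤ) :
    ncoeff J m * ncoeff (bosonStress J) n - ncoeff (bosonStress J) n * ncoeff J m =
      (m : ℂ) • ncoeff J (n + m - 1) +
        (if n = 1 - m then (m * (m - 1) / 2 : ℂ) else 0) • (1 : Module.End ℂ V) := by
  have h1 := hJ.comm_sq m n
  have h2 := hJ.comm_deriv m n
  rw [ncoeff_bosonStress, mul_smul_comm, smul_mul_assoc, ← smul_sub, mul_add, add_mul,
    add_sub_add_comm, h1, h2]
  split_ifs <;> module

/-- The quadratic part is written through `bosonStress` so as to have the same shape as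
`comm_current_fermionCubic`; the leftover multiples of `∂J` and `J` combine into the coefficient of
`J_{n+m-2}`. -/
theorem IsHeisenberg.comm_bosonCubic (hJ : IsHeisenberg J) (m n : ℤ) :
    ncoeff J m * ncoeff (bosonCubic J) n - ncoeff (bosonCubic J) n * ncoeff J m =
      (2 * m : ℂ) • ncoeff (bosonStress J) (n + m - 1) +
      (m * (n + 2 * m - 2) / 2 : ℂ) • ncoeff J (n + m - 2) +
        (if n = 2 - m then (m * (m - 1) * (m - 2) / 12 : ℂ) else 0) • (1 : Module.End ℂ V) := by
  have h1 := hJ.comm_cube m n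
  have h2 := hJ.comm_mul_deriv m n
  have h3 := hJ.comm_deriv_deriv m n
  have h4 : ncoeff (fieldDeriv J) (n + m - 1) = (-(n + m - 1) : ℂ) • ncoeff J (n + m - 2) := by
    rw [ncoeff_fieldDeriv, show n + m - 1 - 1 = n + m - 2 by ring]
    push_cast
    rfl
  rw [ncoeff_bosonCubic, mul_smul_comm, smul_mul_assoc, ← smul_sub, mul_add, add_mul,
    add_sub_add_comm, h3, mul_add, add_mul, add_sub_add_comm, mul_smul_comm, smul_mul_assoc,
    mul_smul_comm, smul_mul_assoc, ← smul_sub, ← smul_sub, h1, h2, ncoeff_bosonStress, h4]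
  split_ifs <;> module

theorem comm_bosonStress_of_homogeneous (L : Module.End ℂ V)
    (hL : ∀ n : ℤ, L * ncoeff J n - ncoeff J n * L = (0 - n : ℂ) • ncoeff J n) (n : ℤ) :
    L * ncoeff (bosonStress J) n - ncoeff (bosonStress J) n * L =
      (1 - n : ℂ) • ncoeff (bosonStress J) n := by
  have h1 := comm_normalMode_of_homogeneous L 1 hL hL n
  have h2 := comm_fieldDeriv_of_homogeneous L hL n
  rw [ncoeff_bosonStress, ncoeff_normalOrder, mul_smul_comm, smul_mul_assoc, ← smul_sub, mul_add,
    add_mul, add_sub_add_comm, h1, h2]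
  module

theorem comm_bosonCubic_of_homogeneous (L : Module.End ℂ V)
    (hL : ∀ n : ℤ, L * ncoeff J n - ncoeff J n * L = (0 - n : ℂ) • ncoeff J n) (n : ℤ) :
    L * ncoeff (bosonCubic J) n - ncoeff (bosonCubic J) n * L =
      (2 - n : ℂ) • ncoeff (bosonCubic J) n := by
  have h1 := comm_normalMode_of_homogeneous L 1 hL (fun k => by
    rw [ncoeff_normalOrder]
    exact comm_normalMode_of_homogeneous L 1 hL hL k) n
  have h2 := comm_normalMode_of_homogeneous L 1 hL (comm_fieldDeriv_of_homogeneous L hL) n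
  have h3 := comm_fieldDeriv_of_homogeneous L (comm_fieldDeriv_of_homogeneous L hL) n
  rw [ncoeff_bosonCubic, ncoeff_normalOrder 1 J (nopEven J J), ncoeff_normalOrder, mul_smul_comm,
    smul_mul_assoc, ← smul_sub, mul_add, add_mul,
    add_sub_add_comm, h3, mul_add, add_mul, add_sub_add_comm, mul_smul_comm, smul_mul_assoc,
    mul_smul_comm, smul_mul_assoc, ← smul_sub, ← smul_sub, h1, h2]
  module

end Heisenberg

/-! ### Fermionic fields as weighted bilinear sums -/

section Fermion

variable {V : Type*} [AddCommGroup V] [Module ℂ V] {β γ : VertexOperator ℂ V} {Ω : V}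

/-- The current `:βγ:`. -/
def current (β γ : VertexOperator ℂ V) : VertexOperator ℂ V := nopOdd β γ

/-- The field `:∂β γ:`. -/
def fermionStress (β γ : VertexOperator ℂ V) : VertexOperator ℂ V := nopOdd (fieldDeriv β) γ

/-- The field `½(:∂²β γ: - :∂β ∂γ:)`. -/
def fermionCubic (β γ : VertexOperator ℂ V) : VertexOperator ℂ V :=
  (1 / 2 : ℂ) • (nopOdd (fieldDeriv (fieldDeriv β)) γ - nopOdd (fieldDeriv β) (fieldDeriv γ))

theorem ncoeff_current (β γ : VertexOperator ℂ V) (n : ℤ) :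
    ncoeff (current β γ) n = bilin β γ (fun _ => 1) (n - 1) := by
  rw [current, ncoeff_normalOrder]
  refine (hasLocSum_normalTerm _ _ _ _).unique ((hasLocSum_bilin β γ _ _).congr fun p => ?_)
  have : n - p - 1 = n - 1 - p := by ring
  unfold normalTerm cutTerm
  rw [this]
  split_ifs <;> simp

theorem ncoeff_fermionStress (β γ : VertexOperator ℂ V) (n : ℤ) :
    ncoeff (fermionStress β γ) n = bilin β γ (fun p => -(p + 1)) (n - 2) := by
  rw [fermionStress, ncoeff_normalOrder]
  refine ((hasLocSum_normalTerm _ _ _ _).shift 1).unique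
    ((hasLocSum_bilin β γ _ _).congr fun p => ?_)
  have e : n - (p + 1) - 1 = n - 2 - p := by ring
  simp only [normalTerm, cutTerm, ncoeff_fieldDeriv, e, add_sub_cancel_right]
  -- After the shift, normal ordering of `∂β` cuts at `p < -1` rather than `p < 0`; this is harmless
  -- because the weight vanishes at `p = -1`.
  rcases lt_trichotomy p (-1) with h | rfl | h
  · rw [if_pos (by lia), if_pos (by lia), smul_mul_assoc]
    push_cast
    rfl
  · simp
  · rw [if_neg (by lia), if_neg (by lia), mul_smul_comm]
    push_cast
    simp

theorem ncoeff_nopOdd_deriv_deriv (β γ : VertexOperator ℂ V) (n : ℤ) :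
    ncoeff (nopOdd (fieldDeriv (fieldDeriv β)) γ) n =
      bilin β γ (fun p => (p + 1) * (p + 2)) (n - 3) := by
  rw [ncoeff_normalOrder]
  refine ((hasLocSum_normalTerm _ _ _ _).shift 2).unique
    ((hasLocSum_bilin β γ _ _).congr fun p => ?_)
  have e : n - (p + 2) - 1 = n - 3 - p := by ring
  have e' : p + 2 - 1 - 1 = p := by ring
  simp only [normalTerm, cutTerm, ncoeff_fieldDeriv, e, e', smul_smul]
  have e2 : -((p + 2 : ℤ) : ℂ) * -((p + 2 - 1 : ℤ) : ℂ) = (p + 1) * (p + 2) := by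
    push_cast
    ring
  rw [e2]
  -- The two cuts disagree only at `p = -1` and `p = -2`, the zeros of the weight.
  by_cases h1 : p = -1
  · simp [h1]
  by_cases h2 : p = -2
  · simp [h2]
  by_cases h : p < -2
  · rw [if_pos (by lia), if_pos (by lia), smul_mul_assoc]
  · rw [if_neg (by lia), if_neg (by lia), mul_smul_comm]
    simp

theorem ncoeff_nopOdd_deriv_left_right (β γ : VertexOperator ℂ V) (n : ℤ) :
    ncoeff (nopOdd (fieldDeriv β) (fieldDeriv γ)) n =
      bilin β γ (fun p => (p + 1) * (n - p - 2)) (n - 3) := by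
  rw [ncoeff_normalOrder]
  refine ((hasLocSum_normalTerm _ _ _ _).shift 1).unique
    ((hasLocSum_bilin β γ _ _).congr fun p => ?_)
  have e : n - (p + 1) - 1 - 1 = n - 3 - p := by ring
  have e' : p + 1 - 1 = p := by ring
  have e2 : -((p + 1 : ℤ) : ℂ) * -((n - (p + 1) - 1 : ℤ) : ℂ) = (p + 1) * (n - p - 2) := by
    push_cast
    ring
  simp only [normalTerm, cutTerm, ncoeff_fieldDeriv, e, e', smul_mul_assoc, mul_smul_comm,
    smul_smul, e2]
  by_cases h1 : p = -1
  · simp [h1]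
  by_cases h : p < -1
  · rw [if_pos (by lia), if_pos (by lia), mul_comm, e2]
  · rw [if_neg (by lia), if_neg (by lia)]
    simp

theorem ncoeff_fermionCubic (β γ : VertexOperator ℂ V) (n : ℤ) :
    ncoeff (fermionCubic β γ) n =
      bilin β γ (fun p => (p + 1) * (2 * p + 4 - n) / 2) (n - 3) := by
  simp only [fermionCubic, map_smul, map_sub, Pi.smul_apply, Pi.sub_apply,
    ncoeff_nopOdd_deriv_deriv, ncoeff_nopOdd_deriv_left_right]
  rw [sub_eq_add_neg, ← neg_one_smul ℂ (bilin β γ (fun p => (p + 1) * (n - p - 2)) (n - 3)),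
    ← bilin_smul, ← bilin_add, ← bilin_smul]
  exact bilin_congr _ _ (fun p => by ring) rfl

namespace IsFermionFock

variable (H : IsFermionFock β γ Ω)
include H

theorem comm_current_b (m k : ℤ) :
    ncoeff (current β γ) m * ncoeff β k - ncoeff β k * ncoeff (current β γ) m =
      ncoeff β (k + m) := by
  rw [ncoeff_current, H.comm_bilin_b, one_smul, show m - 1 + k + 1 = k + m by ring]

theorem comm_current_c (m k : ℤ) :
    ncoeff (current β γ) m * ncoeff γ k - ncoeff γ k * ncoeff (current β γ) m =
      -ncoeff γ (k + m) := by
  rw [ncoeff_current, H.comm_bilin_c, one_smul, show m - 1 + k + 1 = k + m by ring]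

/-- The current raises the index of `β` or of `γ` by `m`, with opposite signs. Reindexing the first
contribution replaces `w(p)` by `w(p - m)` and moves its cut to `m`; restoring the cut at `0` costs
the scalar `g(-m)`. -/
theorem comm_current_bilin {w g : ℤ → ℂ} (h0 : g 0 = 0) (hg : ∀ k, g (k + 1) = g k + w k)
    (m N : ℤ) :
    ncoeff (current β γ) m * bilin β γ w N - bilin β γ w N * ncoeff (current β γ) m =
      bilin β γ (fun p => w (p - m) - w p) (N + m) - (if N + m + 1 = 0 then g (-m) else 0) • 1 := by
  have h1 := ((H.hasLocSum_cutTerm (w := fun p => w (p - m)) (g := fun k => g (k - m) - g (-m))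
    (by simp) (fun k => by rw [add_sub_right_comm, hg]; ring) (N + m) m).shift m).sub
    (hasLocSum_bilin β γ w (N + m))
  have h2 := ((hasLocSum_bilin β γ w N).comm (ncoeff (current β γ) m)).unique
    (h1.congr fun p => ?_)
  · rw [h2, sub_self, h0, zero_sub]
    have h3 : bilin β γ (fun p => w (p - m) - w p) (N + m) =
        bilin β γ (fun p => w (p - m)) (N + m) + (-1 : ℂ) • bilin β γ w (N + m) := by
      rw [← bilin_smul, ← bilin_add]
      exact bilin_congr _ _ (fun p => by ring) rfl
    rw [h3]
    split_ifs <;> module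
  · have e : N + m - (p + m) = N - p := by ring
    have e' : N + m - p = N - p + m := by ring
    simp only [cutTerm, e, e', add_sub_cancel_right]
    by_cases hp : p < 0
    · rw [if_pos hp, if_pos (by lia), if_pos hp, mul_smul_comm, smul_mul_assoc, ← smul_sub,
        comm_mul, H.comm_current_b, H.comm_current_c, mul_neg, ← sub_eq_add_neg, smul_sub]
    · rw [if_neg hp, if_neg (by lia), if_neg hp, mul_neg, neg_mul, mul_smul_comm, smul_mul_assoc,
        ← neg_sub', ← smul_sub, comm_mul, H.comm_current_b, H.comm_current_c, neg_mul,
        neg_add_eq_sub, smul_sub]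
      abel

/-- For constant weight the difference `w(p - m) - w(p)` vanishes, so only the anomaly is left. -/
theorem isHeisenberg_current : IsHeisenberg (current β γ) := fun m n => by
  rw [ncoeff_current β γ n, H.comm_current_bilin (g := fun k => k) (by simp) (by simp)]
  have h0 : bilin β γ (fun _ => (1 : ℂ) - 1) (n - 1 + m) = 0 := by
    have := bilin_smul β γ 0 (fun _ => 1) (n - 1 + m)
    rw [zero_smul] at this
    rw [← this]
    exact bilin_congr _ _ (fun p => by simp) rfl
  rw [h0, zero_sub, ← neg_smul]
  congr 1
  by_cases h : n = -m
  · rw [if_pos h, if_pos (by lia)]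
    simp
  · rw [if_neg h, if_neg (by lia), neg_zero]

theorem comm_current_fermionStress (m n : ℤ) :
    ncoeff (current β γ) m * ncoeff (fermionStress β γ) n -
        ncoeff (fermionStress β γ) n * ncoeff (current β γ) m =
      (m : ℂ) • ncoeff (current β γ) (n + m - 1) +
        (if n = 1 - m then (m * (m - 1) / 2 : ℂ) else 0) • (1 : Module.End ℂ V) := by
  rw [ncoeff_fermionStress, H.comm_current_bilin (g := fun k => -(k * (k + 1)) / 2) (by simp)
    (fun k => by push_cast; ring), ncoeff_current β γ (n + m - 1), ← bilin_smul, sub_eq_add_neg,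
    ← neg_smul]
  congr 1
  · exact bilin_congr _ _ (fun p => by push_cast; ring) (by ring)
  · congr 1
    by_cases h : n = 1 - m
    · rw [if_pos h, if_pos (by lia)]
      push_cast
      ring
    · rw [if_neg h, if_neg (by lia), neg_zero]

theorem comm_current_fermionCubic (m n : ℤ) :
    ncoeff (current β γ) m * ncoeff (fermionCubic β γ) n -
        ncoeff (fermionCubic β γ) n * ncoeff (current β γ) m =
      (2 * m : ℂ) • ncoeff (fermionStress β γ) (n + m - 1) +
      (m * (n + 2 * m - 2) / 2 : ℂ) • ncoeff (current β γ) (n + m - 2) +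
        (if n = 2 - m then (m * (m - 1) * (m - 2) / 12 : ℂ) else 0) • (1 : Module.End ℂ V) := by
  rw [ncoeff_fermionCubic, H.comm_current_bilin
    -- The antiderivative of `(k + 1)(2k + 4 - n)/2` vanishing at `0`.
    (g := fun k => k * (k + 1) * (k + 2) / 3 - n * k * (k + 1) / 4) (by simp)
    (fun k => by push_cast; ring), ncoeff_current β γ (n + m - 2), ncoeff_fermionStress,
    ← bilin_smul, ← bilin_smul, sub_eq_add_neg, ← neg_smul,
    bilin_congr β γ (N := n + m - 1 - 2) (N' := n + m - 2 - 1) (fun _ => rfl) (by ring),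
    ← bilin_add]
  congr 1
  · exact bilin_congr _ _ (fun p => by push_cast; ring) (by ring)
  · congr 1
    by_cases h : n = 2 - m
    · rw [if_pos h, if_pos (by lia), h]
      push_cast
      ring
    · rw [if_neg h, if_neg (by lia), neg_zero]

end IsFermionFock

end Fermion

/-! ### The relations `:Jβ: = ∂β` and `:Jγ: = -∂γ` -/

section Vertex

variable {V : Type*} [AddCommGroup V] [Module ℂ V] {β γ : VertexOperator ℂ V} {Ω : V}

/-- The reflection `i ↦ m - i` permutes the terms and changes their sign, so the sum equals its own
negative. -/
theorem hasLocSum_swap {f : ℤ → Module.End ℂ V} {a : Module.End ℂ V} (h : HasLocSum f a) (m : ℤ)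
    (hf : ∀ i, f (m - i) = -f i) : a = 0 := by
  have h1 := (h.equiv (Equiv.subLeft m)).unique ((h.smul (-1)).congr fun i => by simp [hf])
  rw [neg_one_smul] at h1
  have h2 : (2 : ℂ) • a = 0 := by
    rw [two_smul]
    nth_rewrite 2 [h1]
    exact add_neg_cancel a
  exact (smul_eq_zero.1 h2).resolve_left two_ne_zero

/-- An operator which anticommutes with the modes of both fields and kills the vacuum vanishes. -/
theorem IsFermionFock.eq_zero_of_anticomm (H : IsFermionFock β γ Ω) {X : Module.End ℂ V}
    (hb : ∀ k, X * ncoeff β k = -(ncoeff β k * X)) (hc : ∀ k, X * ncoeff γ k = -(ncoeff γ k * X))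
    (h1 : X Ω = 0) : X = 0 := by
  have : LinearMap.ker X = ⊤ := H.submodule_eq_top (LinearMap.mem_ker.2 h1)
    (fun n v hv => by
      have := LinearMap.congr_fun (hb n) v
      simpa [LinearMap.mem_ker.1 hv] using this)
    (fun n v hv => by
      have := LinearMap.congr_fun (hc n) v
      simpa [LinearMap.mem_ker.1 hv] using this)
  exact LinearMap.ker_eq_top.1 this

/-- A family of operators shifted by the modes of a field, and vanishing for `n ≥ 0`, vanishes. -/
theorem eq_zero_of_comm_shift {J : VertexOperator ℂ V} {X : ℤ → Module.End ℂ V} {ε : ℂ}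
    (hε : ε ≠ 0) (h : ∀ m n, ncoeff J m * X n - X n * ncoeff J m = ε • X (n + m))
    (h0 : ∀ n, 0 ≤ n → X n = 0) (n : ℤ) : X n = 0 := by
  have := h n 0
  rw [h0 0 le_rfl, mul_zero, zero_mul, sub_zero, zero_add] at this
  exact (smul_eq_zero.1 this.symm).resolve_left hε

namespace IsFermionFock

variable (H : IsFermionFock β γ Ω)
include H

theorem current_mul_b (m k : ℤ) :
    ncoeff (current β γ) m * ncoeff β k = ncoeff β k * ncoeff (current β γ) m + ncoeff β (k + m) :=
  sub_eq_iff_eq_add'.1 (H.comm_current_b m k)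

theorem current_mul_c (m k : ℤ) :
    ncoeff (current β γ) m * ncoeff γ k = ncoeff γ k * ncoeff (current β γ) m - ncoeff γ (k + m) := by
  have := H.comm_current_c m k
  rw [sub_eq_iff_eq_add'] at this
  rw [this, sub_eq_add_neg]

/-- The anticommutator is the sum of `β_{n-i-1} β_{k+i}`, antisymmetric under exchanging the two
factors. -/
theorem normalMode_current_b_mul_b (n k : ℤ) :
    normalMode 1 (current β γ) β n * ncoeff β k =
      -(ncoeff β k * normalMode 1 (current β γ) β n) := by
  have h := ((hasLocSum_normalTerm 1 (current β γ) β n).mul_right (ncoeff β k)).add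
    ((hasLocSum_normalTerm 1 (current β γ) β n).mul_left (ncoeff β k))
  refine eq_neg_of_add_eq_zero_left (hasLocSum_swap (f := fun i =>
    ncoeff β (n - i - 1) * ncoeff β (k + i)) (h.congr fun i => ?_) (n - 1 - k) fun i => ?_)
  · simp only [normalTerm, Units.val_one, Int.cast_one, one_smul]
    by_cases hi : i < 0
    · simp only [if_pos hi]
      rw [mul_assoc, H.b_mul_b (n - i - 1) k, ← mul_assoc, mul_neg, ← mul_assoc,
        H.current_mul_b, H.b_mul_b (n - i - 1) (k + i)]
      noncomm_ring
    · simp only [if_neg hi]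
      rw [mul_assoc, H.current_mul_b, mul_add, ← mul_assoc, H.b_mul_b (n - i - 1) k]
      noncomm_ring
  · rw [H.b_mul_b, show n - (n - 1 - k - i) - 1 = k + i by ring,
      show k + (n - 1 - k - i) = n - i - 1 by ring]

theorem normalMode_current_c_mul_c (n k : ℤ) :
    normalMode 1 (current β γ) γ n * ncoeff γ k =
      -(ncoeff γ k * normalMode 1 (current β γ) γ n) := by
  have h := ((hasLocSum_normalTerm 1 (current β γ) γ n).mul_right (ncoeff γ k)).add
    ((hasLocSum_normalTerm 1 (current β γ) γ n).mul_left (ncoeff γ k))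
  refine eq_neg_of_add_eq_zero_left (hasLocSum_swap (f := fun i =>
    -(ncoeff γ (n - i - 1) * ncoeff γ (k + i))) (h.congr fun i => ?_) (n - 1 - k) fun i => ?_)
  · simp only [normalTerm, Units.val_one, Int.cast_one, one_smul]
    by_cases hi : i < 0
    · simp only [if_pos hi]
      rw [mul_assoc, H.c_mul_c (n - i - 1) k, ← mul_assoc, mul_neg, ← mul_assoc,
        H.current_mul_c, H.c_mul_c (n - i - 1) (k + i)]
      noncomm_ring
    · simp only [if_neg hi]
      rw [mul_assoc, H.current_mul_c, mul_sub, ← mul_assoc, H.c_mul_c (n - i - 1) k]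
      noncomm_ring
  · rw [H.c_mul_c, show n - (n - 1 - k - i) - 1 = k + i by ring,
      show k + (n - 1 - k - i) = n - i - 1 by ring]

/-- The anticommutator is `J_{n+k}` minus the same mode of the current summed with its cut at `n`;
the difference is the anomaly for weight `1`. -/
theorem normalMode_current_b_mul_c (n k : ℤ) :
    normalMode 1 (current β γ) β n * ncoeff γ k + ncoeff γ k * normalMode 1 (current β γ) β n =
      (if n + k = 0 then -(n : ℂ) else 0) • 1 := by
  have h := ((hasLocSum_normalTerm 1 (current β γ) β n).mul_right (ncoeff γ k)).add
    ((hasLocSum_normalTerm 1 (current β γ) β n).mul_left (ncoeff γ k))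
  have h2 := (H.hasLocSum_cutTerm (w := fun _ => 1) (g := fun k => (k : ℂ)) (by simp) (by simp)
    (n + k - 1) n).equiv (Equiv.subLeft (n - 1))
  have h3 := h.unique (((hasLocSum_single (n + k) (ncoeff (current β γ) (n + k))).sub h2).congr
    fun i => ?_)
  · rw [h3, ncoeff_current, sub_add_eq_sub_sub, sub_self, zero_sub, ← neg_smul]
    congr 1
    simp only [sub_add_cancel]
    split_ifs <;> simp
  · have e : n + k - 1 - (n - 1 - i) = k + i := by ring
    have e' : n - i - 1 = n - 1 - i := by ring
    have hs : (if i = n + k then ncoeff (current β γ) (n + k) else 0) =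
        ncoeff (current β γ) i * (if n - 1 - i + k + 1 = 0 then 1 else 0) := by
      by_cases hi : i = n + k
      · rw [if_pos hi, if_pos (by lia), hi, mul_one]
      · rw [if_neg hi, if_neg (by lia), mul_zero]
    have hs' : ncoeff (current β γ) i * (if n - 1 - i + k + 1 = 0 then 1 else 0) =
        (if n - 1 - i + k + 1 = 0 then 1 else 0) * ncoeff (current β γ) i := by
      split_ifs <;> simp
    simp only [normalTerm, cutTerm, Equiv.subLeft_apply, Units.val_one, Int.cast_one, one_smul, e,
      e', hs]
    by_cases hi : i < 0
    · rw [if_pos hi, if_neg (show ¬ n - 1 - i < n by lia), mul_assoc, H.b_mul_c, ← mul_assoc,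
        show ncoeff γ k * ncoeff (current β γ) i = ncoeff (current β γ) i * ncoeff γ k +
          ncoeff γ (k + i) by rw [H.current_mul_c]; abel]
      noncomm_ring
    · rw [if_neg hi, if_pos (show n - 1 - i < n by lia), mul_assoc, H.current_mul_c, mul_sub, ← mul_assoc, H.b_mul_c,
        hs']
      noncomm_ring

theorem normalMode_current_c_mul_b (n k : ℤ) :
    normalMode 1 (current β γ) γ n * ncoeff β k + ncoeff β k * normalMode 1 (current β γ) γ n =
      (if n + k = 0 then (n : ℂ) else 0) • 1 := by
  have h := ((hasLocSum_normalTerm 1 (current β γ) γ n).mul_right (ncoeff β k)).add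
    ((hasLocSum_normalTerm 1 (current β γ) γ n).mul_left (ncoeff β k))
  have h2 := (H.hasLocSum_cutTerm (w := fun _ => 1) (g := fun k => (k : ℂ)) (by simp) (by simp)
    (n + k - 1) k).shift k
  have h3 := h.unique (((hasLocSum_single (n + k) (ncoeff (current β γ) (n + k))).sub h2).congr
    fun i => ?_)
  · rw [h3, ncoeff_current, sub_add_eq_sub_sub, sub_self, zero_sub, ← neg_smul]
    congr 1
    simp only [sub_add_cancel]
    split_ifs with h
    · rw [show k = -n by lia]
      simp
    · simp
  · have e : n + k - 1 - (i + k) = n - 1 - i := by ring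
    have e' : n - i - 1 = n - 1 - i := by ring
    have hs : (if i = n + k then ncoeff (current β γ) (n + k) else 0) =
        ncoeff (current β γ) i * (if n - 1 - i + k + 1 = 0 then 1 else 0) := by
      by_cases hi : i = n + k
      · rw [if_pos hi, if_pos (by lia), hi, mul_one]
      · rw [if_neg hi, if_neg (by lia), mul_zero]
    have hs' : ncoeff (current β γ) i * (if n - 1 - i + k + 1 = 0 then 1 else 0) =
        (if n - 1 - i + k + 1 = 0 then 1 else 0) * ncoeff (current β γ) i := by
      split_ifs <;> simp
    simp only [normalTerm, cutTerm, Units.val_one, Int.cast_one, one_smul, e, e', hs]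
    rw [add_comm i k]
    by_cases hi : i < 0
    · rw [if_pos hi, if_pos (show k + i < k by lia), mul_assoc, H.c_mul_b, ← mul_assoc,
        show ncoeff β k * ncoeff (current β γ) i = ncoeff (current β γ) i * ncoeff β k -
          ncoeff β (k + i) by rw [H.current_mul_b]; abel]
      noncomm_ring
    · rw [if_neg hi, if_neg (show ¬ k + i < k by lia), mul_assoc, H.current_mul_b, mul_add, ← mul_assoc, H.c_mul_b,
        hs']
      noncomm_ring

omit H in
theorem normalMode_vacuum {ε : ℤˣ} {A B : VertexOperator ℂ V}
    (hA : ∀ n : ℤ, 0 ≤ n → ncoeff A n Ω = 0) (hB : ∀ n : ℤ, 0 ≤ n → ncoeff B n Ω = 0) {n : ℤ}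
    (hn : 0 ≤ n) : normalMode ε A B n Ω = 0 := by
  rw [← (hasLocSum_normalTerm ε A B n Ω).2]
  refine (finsum_congr fun i => ?_).trans finsum_zero
  change normalTerm ε A B n i Ω = 0
  unfold normalTerm
  split_ifs with hi
  · rw [Module.End.mul_apply, hB _ (by lia), map_zero]
  · rw [LinearMap.smul_apply, Module.End.mul_apply, hA _ (by lia), map_zero, smul_zero]

theorem bilin_vacuum (w : ℤ → ℂ) {N : ℤ} (hN : -1 ≤ N) : bilin β γ w N Ω = 0 :=
  normalMode_vacuum (fun n hn => by simp [weighted, H.b_vacuum hn]) (fun n hn => H.c_vacuum hn)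
    (by lia)

theorem current_vacuum {n : ℤ} (hn : 0 ≤ n) : ncoeff (current β γ) n Ω = 0 := by
  rw [ncoeff_current]
  exact H.bilin_vacuum _ (by lia)

/-- The relation `:Jβ: = ∂β`. -/
theorem normalMode_current_b (n : ℤ) :
    normalMode 1 (current β γ) β n = (-n : ℂ) • ncoeff β (n - 1) := by
  suffices h : normalMode 1 (current β γ) β n + (n : ℂ) • ncoeff β (n - 1) = 0 by
    rw [eq_neg_of_add_eq_zero_left h, neg_smul]
  -- The defect `X_n` anticommutes with all `β_k` and `γ_k`, and kills the vacuum when `n ≥ 0`, so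
  -- it vanishes there. Negative modes follow from `[J_n, X_0] = X_n`.
  refine eq_zero_of_comm_shift (J := current β γ) one_ne_zero
    (X := fun n => normalMode 1 (current β γ) β n + (n : ℂ) • ncoeff β (n - 1)) (fun m n => ?_)
    (fun n hn => H.eq_zero_of_anticomm (fun k => ?_) (fun k => ?_) ?_) n
  · have h1 := H.isHeisenberg_current.comm_normalMode_of_field (B := β) (C := β) (r := 1) (d := m)
      (fun k => by rw [H.comm_current_b, one_smul]) n
    have h2 := H.comm_current_b m (n - 1)
    rw [mul_add, add_mul, add_sub_add_comm, h1, mul_smul_comm, smul_mul_assoc, ← smul_sub, h2,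
      show n - 1 + m = n + m - 1 by ring]
    push_cast
    module
  · rw [add_mul, mul_add, H.normalMode_current_b_mul_b, smul_mul_assoc, mul_smul_comm,
      H.b_mul_b (n - 1)]
    module
  · have h1 := H.normalMode_current_b_mul_c n k
    have h2 : (n : ℂ) • (ncoeff β (n - 1) * ncoeff γ k) + (n : ℂ) • (ncoeff γ k * ncoeff β (n - 1)) =
        (if n + k = 0 then (n : ℂ) else 0) • 1 := by
      rw [← smul_add, H.b_mul_c, sub_add_cancel, show n - 1 + k + 1 = n + k by ring]
      split_ifs <;> simp
    refine eq_neg_of_add_eq_zero_left ?_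
    rw [add_mul, mul_add, add_add_add_comm, h1, smul_mul_assoc, mul_smul_comm, h2, ← add_smul]
    split_ifs <;> simp
  · rw [LinearMap.add_apply, normalMode_vacuum (fun _ => H.current_vacuum)
      (fun _ => H.b_vacuum) hn, zero_add, LinearMap.smul_apply]
    rcases hn.eq_or_lt with rfl | h
    · simp
    · rw [H.b_vacuum (by lia), smul_zero]

/-- The relation `:Jγ: = -∂γ`. -/
theorem normalMode_current_c (n : ℤ) :
    normalMode 1 (current β γ) γ n = (n : ℂ) • ncoeff γ (n - 1) := by
  suffices h : normalMode 1 (current β γ) γ n - (n : ℂ) • ncoeff γ (n - 1) = 0 from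
    sub_eq_zero.1 h
  refine eq_zero_of_comm_shift (J := current β γ) (neg_ne_zero.2 one_ne_zero)
    (X := fun n => normalMode 1 (current β γ) γ n - (n : ℂ) • ncoeff γ (n - 1)) (fun m n => ?_)
    (fun n hn => H.eq_zero_of_anticomm (fun k => ?_) (fun k => ?_) ?_) n
  · have h1 := H.isHeisenberg_current.comm_normalMode_of_field (B := γ) (C := γ) (r := -1) (d := m)
      (fun k => by rw [H.comm_current_c, neg_one_smul]) n
    have h2 := H.comm_current_c m (n - 1)
    rw [mul_sub, sub_mul, sub_sub_sub_comm, h1, mul_smul_comm, smul_mul_assoc, ← smul_sub, h2,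
      show n - 1 + m = n + m - 1 by ring]
    push_cast
    module
  · have h1 := H.normalMode_current_c_mul_b n k
    have h2 : (n : ℂ) • (ncoeff γ (n - 1) * ncoeff β k) + (n : ℂ) • (ncoeff β k * ncoeff γ (n - 1)) =
        (if n + k = 0 then (n : ℂ) else 0) • 1 := by
      rw [← smul_add, H.c_mul_b, sub_add_cancel, show n - 1 + k + 1 = n + k by ring]
      split_ifs <;> simp
    refine eq_neg_of_add_eq_zero_left ?_
    rw [sub_mul, mul_sub, sub_add_sub_comm, h1, smul_mul_assoc, mul_smul_comm, h2, sub_self]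
  · rw [sub_mul, mul_sub, H.normalMode_current_c_mul_c, smul_mul_assoc, mul_smul_comm,
      H.c_mul_c (n - 1)]
    module
  · rw [LinearMap.sub_apply, normalMode_vacuum (fun _ => H.current_vacuum)
      (fun _ => H.c_vacuum) hn, zero_sub, LinearMap.smul_apply]
    rcases hn.eq_or_lt with rfl | h
    · simp
    · rw [H.c_vacuum (by lia), smul_zero, neg_zero]

end IsFermionFock

end Vertex

/-! ## Charged vacua -/

section Vacua

variable {V : Type*} [AddCommGroup V] [Module ℂ V] {β γ : VertexOperator ℂ V} {Ω : V}

/-- The vector `b(-k+1) ⋯ b(-1) b(0) Ω`. -/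
def posVacuum (β : VertexOperator ℂ V) (Ω : V) : ℕ → V
  | 0 => Ω
  | k + 1 => ncoeff β (-k - 1) (posVacuum β Ω k)

/-- The vector `c(-k) ⋯ c(-1) Ω`. -/
def negVacuum (γ : VertexOperator ℂ V) (Ω : V) : ℕ → V
  | 0 => Ω
  | k + 1 => ncoeff γ (-k - 1) (negVacuum γ Ω k)

/-- The highest weight vector of charge `l`. -/
def chargedVacuum (β γ : VertexOperator ℂ V) (Ω : V) : ℤ → V
  | Int.ofNat k => posVacuum β Ω k
  | Int.negSucc k => negVacuum γ Ω (k + 1)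

theorem chargedVacuum_neg_natCast (k : ℕ) : chargedVacuum β γ Ω (-k) = negVacuum γ Ω k := by
  cases k <;> rfl

theorem mul_self_eq_zero_of_anticomm {X : Module.End ℂ V} (h : X * X = -(X * X)) : X * X = 0 := by
  have h2 : (2 : ℂ) • (X * X) = 0 := by
    rw [two_smul]
    nth_rewrite 2 [h]
    exact add_neg_cancel _
  exact (smul_eq_zero.1 h2).resolve_left two_ne_zero

namespace IsFermionFock

variable (H : IsFermionFock β γ Ω)
include H

theorem b_b_apply (m n : ℤ) (v : V) :
    ncoeff β m (ncoeff β n v) = -ncoeff β n (ncoeff β m v) := LinearMap.congr_fun (H.b_mul_b m n) v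

theorem c_c_apply (m n : ℤ) (v : V) :
    ncoeff γ m (ncoeff γ n v) = -ncoeff γ n (ncoeff γ m v) := LinearMap.congr_fun (H.c_mul_c m n) v

theorem b_c_apply (m n : ℤ) (v : V) :
    ncoeff β m (ncoeff γ n v) = (if m + n + 1 = 0 then v else 0) - ncoeff γ n (ncoeff β m v) := by
  refine (LinearMap.congr_fun (H.b_mul_c m n) v).trans ?_
  split_ifs <;> simp

theorem c_b_apply (m n : ℤ) (v : V) :
    ncoeff γ m (ncoeff β n v) = (if m + n + 1 = 0 then v else 0) - ncoeff β n (ncoeff γ m v) := by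
  refine (LinearMap.congr_fun (H.c_mul_b m n) v).trans ?_
  split_ifs <;> simp

/-- Pauli exclusion: the modes `β_{-1}, …, β_{-k}` are already occupied, and `γ_n` with `n ≥ k` has
no occupied partner to remove. -/
theorem annihilate_posVacuum (k : ℕ) :
    (∀ n : ℤ, -(k : ℤ) ≤ n → ncoeff β n (posVacuum β Ω k) = 0) ∧
      ∀ n : ℤ, (k : ℤ) ≤ n → ncoeff γ n (posVacuum β Ω k) = 0 := by
  induction k with
  | zero => exact ⟨fun n hn => H.b_vacuum (by simpa using hn), fun n hn => H.c_vacuum hn⟩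
  | succ k ih =>
    refine ⟨fun n hn => ?_, fun n hn => ?_⟩
    · rw [posVacuum]
      by_cases h : n = -k - 1
      · rw [h]
        exact LinearMap.congr_fun (mul_self_eq_zero_of_anticomm (H.b_mul_b _ _)) _
      · rw [H.b_b_apply, ih.1 n (by push_cast at hn; lia), map_zero, neg_zero]
    · push_cast at hn
      rw [posVacuum, H.c_b_apply, if_neg (by lia), ih.2 n (by lia), map_zero, sub_zero]

theorem annihilate_negVacuum (k : ℕ) :
    (∀ n : ℤ, (k : ℤ) ≤ n → ncoeff β n (negVacuum γ Ω k) = 0) ∧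
      ∀ n : ℤ, -(k : ℤ) ≤ n → ncoeff γ n (negVacuum γ Ω k) = 0 := by
  induction k with
  | zero => exact ⟨fun n hn => H.b_vacuum hn, fun n hn => H.c_vacuum (by simpa using hn)⟩
  | succ k ih =>
    refine ⟨fun n hn => ?_, fun n hn => ?_⟩
    · push_cast at hn
      rw [negVacuum, H.b_c_apply, if_neg (by lia), ih.1 n (by lia), map_zero, sub_zero]
    · rw [negVacuum]
      by_cases h : n = -k - 1
      · rw [h]
        exact LinearMap.congr_fun (mul_self_eq_zero_of_anticomm (H.c_mul_c _ _)) _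
      · rw [H.c_c_apply, ih.2 n (by push_cast at hn; lia), map_zero, neg_zero]

theorem b_chargedVacuum_eq_zero {l n : ℤ} (hn : -l ≤ n) :
    ncoeff β n (chargedVacuum β γ Ω l) = 0 := by
  obtain ⟨k, rfl | rfl⟩ := l.eq_nat_or_neg
  · exact (H.annihilate_posVacuum k).1 n hn
  · rw [chargedVacuum_neg_natCast]
    exact (H.annihilate_negVacuum k).1 n (by simpa using hn)

theorem c_chargedVacuum_eq_zero {l n : ℤ} (hn : l ≤ n) :
    ncoeff γ n (chargedVacuum β γ Ω l) = 0 := by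
  obtain ⟨k, rfl | rfl⟩ := l.eq_nat_or_neg
  · exact (H.annihilate_posVacuum k).2 n hn
  · rw [chargedVacuum_neg_natCast]
    exact (H.annihilate_negVacuum k).2 n hn

/-- A single ladder rule for both signs of `l`: for negative `l` the mode of `β` removes the
outermost `γ` instead of adding a fermion. -/
theorem chargedVacuum_add_one (l : ℤ) :
    chargedVacuum β γ Ω (l + 1) = ncoeff β (-l - 1) (chargedVacuum β γ Ω l) := by
  obtain k | k := l
  · rfl
  · have h1 : (Int.negSucc k) + 1 = -(k : ℤ) := by lia
    have h2 : chargedVacuum β γ Ω (Int.negSucc k) = ncoeff γ (-k - 1) (negVacuum γ Ω k) := rfl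
    rw [h1, h2, chargedVacuum_neg_natCast, H.b_c_apply, if_pos (by lia),
      (H.annihilate_negVacuum k).1 _ (by lia), map_zero, sub_zero]

theorem c_chargedVacuum_add_one (l : ℤ) :
    ncoeff γ l (chargedVacuum β γ Ω (l + 1)) = chargedVacuum β γ Ω l := by
  rw [H.chargedVacuum_add_one, H.c_b_apply, if_pos (by ring), H.c_chargedVacuum_eq_zero le_rfl,
    map_zero, sub_zero]

/-- The steps of the ladder are inverted by modes of `γ`, so nonvanishing propagates from charge `0`
in both directions. -/
theorem chargedVacuum_ne_zero (l : ℤ) : chargedVacuum β γ Ω l ≠ 0 := by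
  induction l using Int.induction_on with
  | zero => exact H.vacuum_ne_zero
  | succ k ih =>
    intro h
    rw [← H.c_chargedVacuum_add_one, h, map_zero] at ih
    exact ih rfl
  | pred k ih =>
    intro h
    rw [← sub_add_cancel (-(k : ℤ)) 1, H.chargedVacuum_add_one, h, map_zero] at ih
    exact ih rfl

theorem current_chargedVacuum_eq_zero {m : ℤ} (hm : 0 < m) (l : ℤ) :
    ncoeff (current β γ) m (chargedVacuum β γ Ω l) = 0 := by
  induction l using Int.induction_on with
  | zero => exact H.current_vacuum hm.le
  | succ k ih =>
    have h := LinearMap.congr_fun (H.current_mul_b m (-k - 1)) (chargedVacuum β γ Ω k)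
    simp only [Module.End.mul_apply, LinearMap.add_apply] at h
    rw [H.chargedVacuum_add_one, h, ih, map_zero, H.b_chargedVacuum_eq_zero (by lia), zero_add]
  | pred k ih =>
    have h := LinearMap.congr_fun (H.current_mul_c m (-k - 1)) (chargedVacuum β γ Ω (-k - 1 + 1))
    simp only [Module.End.mul_apply, LinearMap.sub_apply] at h
    rw [← H.c_chargedVacuum_add_one, h, H.c_chargedVacuum_eq_zero (by lia), sub_add_cancel, ih,
      map_zero, sub_zero]

/-- For `N = -1` the operator has `β_k` as an eigenvector of its commutator, with eigenvalue `w k`.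
Passing from charge `l` to `l + 1` applies `β_{-l-1}`, so the eigenvalue grows by `w (-l-1)`. -/
theorem bilin_chargedVacuum {w g : ℤ → ℂ} (h0 : g 0 = 0) (hg : ∀ l, g (l + 1) = g l + w (-l - 1))
    (l : ℤ) : bilin β γ w (-1) (chargedVacuum β γ Ω l) = g l • chargedVacuum β γ Ω l := by
  induction l using Int.induction_on with
  | zero =>
    rw [h0, zero_smul]
    exact H.bilin_vacuum w le_rfl
  | succ k ih =>
    have h := LinearMap.congr_fun (H.comm_bilin_b w (-1) (-k - 1)) (chargedVacuum β γ Ω k)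
    simp only [Module.End.mul_apply, LinearMap.sub_apply, LinearMap.smul_apply] at h
    rw [ih, map_smul, sub_eq_iff_eq_add, ← H.chargedVacuum_add_one,
      show -1 + (-(k : ℤ) - 1) + 1 = -k - 1 by ring, ← H.chargedVacuum_add_one, ← add_smul] at h
    rw [h, hg, add_comm]
  | pred k ih =>
    have h := LinearMap.congr_fun (H.comm_bilin_c w (-1) (-k - 1))
      (chargedVacuum β γ Ω (-k - 1 + 1))
    simp only [Module.End.mul_apply, LinearMap.sub_apply, LinearMap.neg_apply,
      LinearMap.smul_apply] at h
    have e := hg (-k - 1)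
    rw [sub_add_cancel] at e
    rw [H.c_chargedVacuum_add_one, sub_add_cancel, ih, map_smul, sub_eq_iff_eq_add,
      show -1 + (-(k : ℤ) - 1) + 1 = -k - 1 by ring] at h
    have h' := H.c_chargedVacuum_add_one (-k - 1)
    rw [sub_add_cancel] at h'
    rw [h, h', e]
    module

theorem current_zero_chargedVacuum (l : ℤ) :
    ncoeff (current β γ) 0 (chargedVacuum β γ Ω l) = (l : ℂ) • chargedVacuum β γ Ω l := by
  rw [ncoeff_current]
  exact H.bilin_chargedVacuum (g := fun l => (l : ℂ)) (by simp) (by simp) l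

theorem fermionStress_chargedVacuum (l : ℤ) :
    ncoeff (fermionStress β γ) 1 (chargedVacuum β γ Ω l) =
      (l * (l - 1) / 2 : ℂ) • chargedVacuum β γ Ω l := by
  rw [ncoeff_fermionStress]
  exact H.bilin_chargedVacuum (g := fun l => (l * (l - 1) / 2 : ℂ)) (by simp)
    (fun l => by push_cast; ring) l

theorem fermionCubic_chargedVacuum (l : ℤ) :
    ncoeff (fermionCubic β γ) 2 (chargedVacuum β γ Ω l) =
      (l * (l - 1) * (2 * l - 1) / 6 : ℂ) • chargedVacuum β γ Ω l := by
  rw [ncoeff_fermionCubic]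
  exact H.bilin_chargedVacuum (g := fun l => (l * (l - 1) * (2 * l - 1) / 6 : ℂ)) (by simp)
    (fun l => by push_cast; ring) l

end IsFermionFock

end Vacua

/-! ## Highest weight representations of the Heisenberg algebra -/

section HighestWeight

variable {V : Type*} [AddCommGroup V] [Module ℂ V]

/-- The subalgebra generated by a commuting family is commutative, so polynomial evaluation is
available there. -/
theorem exists_algHom_of_commute {σ A : Type*} [Ring A] [Algebra ℂ A] (f : σ → A)
    (hf : ∀ i k, f i * f k = f k * f i) :
    ∃ φ : MvPolynomial σ ℂ →ₐ[ℂ] A, ∀ i, φ (MvPolynomial.X i) = f i := by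
  have hc : ∀ x ∈ Set.range f, ∀ y ∈ Set.range f, x * y = y * x := by
    rintro _ ⟨i, rfl⟩ _ ⟨k, rfl⟩
    exact hf i k
  let A' := Algebra.adjoin ℂ (Set.range f)
  have hcomm := (Algebra.isMulCommutative_adjoin ℂ hc).is_comm.comm
  let _ : CommRing A' := { A'.toRing with mul_comm := hcomm }
  refine ⟨A'.val.comp (MvPolynomial.aeval fun i : σ => (⟨f i, Algebra.subset_adjoin ⟨i, rfl⟩⟩ : A')), fun i => ?_⟩
  simp

theorem heisMode_zero (α : ℂ) (p : Heis) : heisMode α 0 p = α • p := rfl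

theorem heisMode_natCast_add_one (α : ℂ) (k : ℕ) (p : Heis) :
    heisMode α (k + 1) p = (k + 1 : ℂ) • MvPolynomial.pderiv k p := rfl

theorem heisMode_negSucc (α : ℂ) (k : ℕ) (p : Heis) :
    heisMode α (Int.negSucc k) p = MvPolynomial.X k * p := rfl

theorem eq_C_of_pderiv_eq_zero {p : Heis} (h : ∀ k, MvPolynomial.pderiv k p = 0) :
    p = MvPolynomial.C (p.coeff 0) := by
  ext m
  rw [MvPolynomial.coeff_C]
  split_ifs with hm
  · rw [hm]
  · obtain ⟨i, hi⟩ : ∃ i, m i ≠ 0 := by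
      by_contra hcon
      push Not at hcon
      exact hm (Finsupp.ext fun i => (hcon i).symm)
    have := congrArg (MvPolynomial.coeff (m - Finsupp.single i 1)) (h i)
    rw [MvPolynomial.coeff_pderiv, MvPolynomial.coeff_zero, tsub_add_cancel_of_le
      (Finsupp.single_le_iff.2 (Nat.one_le_iff_ne_zero.2 hi))] at this
    exact (mul_eq_zero.1 this).resolve_right (Nat.cast_add_one_ne_zero _)

variable {J : VertexOperator ℂ V} {α : ℂ}

/-- A highest weight vector of weight `α` generates an image of the Fock space `𝓗_α`. -/
theorem IsHeisenberg.exists_intertwiner (hJ : IsHeisenberg J) {v : V}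
    (h0 : ncoeff J 0 v = α • v) (hpos : ∀ m : ℤ, 0 < m → ncoeff J m v = 0) :
    ∃ ψ : Heis →ₗ[ℂ] V, ψ 1 = v ∧ ∀ n x, ψ (heisMode α n x) = ncoeff J n (ψ x) := by
  obtain ⟨φ, hφ⟩ := exists_algHom_of_commute (fun k : ℕ => ncoeff J (Int.negSucc k))
    (fun i k => by
      have := hJ (Int.negSucc i) (Int.negSucc k)
      rwa [if_neg (by lia), zero_smul, sub_eq_zero] at this)
  have hcomm : ∀ (n : ℤ) (i : ℕ) (w : V), ncoeff J n (ncoeff J (Int.negSucc i) w) =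
      ncoeff J (Int.negSucc i) (ncoeff J n w) + (if n = i + 1 then (n : ℂ) else 0) • w :=
    fun n i w => by
      have := LinearMap.congr_fun (hJ n (Int.negSucc i)) w
      simp only [LinearMap.sub_apply, Module.End.mul_apply, LinearMap.smul_apply,
        Module.End.one_apply] at this
      rw [sub_eq_iff_eq_add'.1 this]
      congr 3
      rw [eq_iff_iff]
      lia
  have hX : ∀ (p : Heis) (i : ℕ),
      φ (p * MvPolynomial.X i) v = ncoeff J (Int.negSucc i) (φ p v) := fun p i => by
    rw [mul_comm, map_mul, hφ]
    rfl
  refine ⟨(LinearMap.applyₗ v).comp φ.toLinearMap, by simp, fun n x => ?_⟩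
  change φ (heisMode α n x) v = ncoeff J n (φ x v)
  obtain (_ | k) | k := n
  · change φ (heisMode α 0 x) v = ncoeff J 0 (φ x v)
    simp only [heisMode_zero, map_smul, LinearMap.smul_apply]
    induction x using MvPolynomial.induction_on with
    | C a =>
      rw [← MvPolynomial.algebraMap_eq, AlgHom.commutes, Module.algebraMap_end_apply, map_smul, h0,
        smul_comm]
    | add p q hp hq => rw [map_add, LinearMap.add_apply, smul_add, hp, hq, map_add]
    | mul_X p i hp =>
      rw [hX, hcomm, ← hp, if_neg (by lia), zero_smul, add_zero, map_smul]
  · change φ (heisMode α (k + 1) x) v = ncoeff J (k + 1) (φ x v)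
    simp only [heisMode_natCast_add_one, map_smul, LinearMap.smul_apply]
    induction x using MvPolynomial.induction_on with
    | C a =>
      rw [← MvPolynomial.algebraMap_eq, AlgHom.commutes, Module.algebraMap_end_apply, map_smul,
        hpos _ (by lia), smul_zero, MvPolynomial.algebraMap_eq, MvPolynomial.pderiv_C, map_zero,
        LinearMap.zero_apply, smul_zero]
    | add p q hp hq => rw [map_add, map_add, map_add, LinearMap.add_apply, smul_add, hp, hq,
        LinearMap.add_apply, map_add]
    | mul_X p i hp =>
      rw [hX, hcomm, ← hp, Derivation.leibniz, smul_eq_mul, smul_eq_mul, MvPolynomial.pderiv_X,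
        map_add, LinearMap.add_apply, mul_comm (MvPolynomial.X i), hX, map_smul, smul_add, add_comm]
      congr 1
      by_cases h : k = i
      · subst h
        simp
      · rw [Pi.single_eq_of_ne (by lia), if_neg (by lia)]
        simp
  · rw [heisMode_negSucc, mul_comm, hX]

/-- The kernel is stable under partial derivatives, since these are positive modes up to nonzero
factors. By induction on degree, all derivatives of a kernel element vanish; it is then constant,
hence zero because `ψ 1 ≠ 0`. -/
theorem injective_of_intertwines {ψ : Heis →ₗ[ℂ] V} (h1 : ψ 1 ≠ 0)
    (hψ : ∀ n x, ψ (heisMode α n x) = ncoeff J n (ψ x)) : Function.Injective ψ := by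
  rw [injective_iff_map_eq_zero]
  intro p
  induction hd : p.totalDegree using Nat.strong_induction_on generalizing p with
  | _ d ih =>
    intro hp
    have hder : ∀ k, MvPolynomial.pderiv k p = 0 := fun k => by
      by_contra hk
      have hlt : (MvPolynomial.pderiv k p).totalDegree < d := by
        obtain ⟨m, hm, he⟩ := Finset.exists_mem_eq_sup _ (MvPolynomial.support_nonempty.2 hk)
          fun m : ℕ →₀ ℕ => m.degree
        have hm' : m + Finsupp.single k 1 ∈ p.support := by
          rw [MvPolynomial.mem_support_iff, MvPolynomial.coeff_pderiv] at hm
          exact MvPolynomial.mem_support_iff.2 (left_ne_zero_of_mul hm)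
        have hle := MvPolynomial.le_totalDegree hm'
        change (MvPolynomial.pderiv k p).totalDegree = _ at he
        rw [he, ← hd]
        change (m + Finsupp.single k 1).degree ≤ _ at hle
        rw [map_add, Finsupp.degree_single] at hle
        lia
      refine hk (ih _ hlt _ rfl ?_)
      have := hψ (k + 1) p
      rw [hp, map_zero, heisMode_natCast_add_one, map_smul] at this
      exact (smul_eq_zero.1 this).resolve_left (Nat.cast_add_one_ne_zero k)
    have hC := eq_C_of_pderiv_eq_zero hder
    rw [← mul_one (MvPolynomial.C _), ← MvPolynomial.smul_eq_C_mul] at hC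
    rw [hC, map_smul] at hp
    rw [hC, (smul_eq_zero.1 hp).resolve_right h1, zero_smul]

/-- The singular vectors of an irreducible highest weight representation are multiples of the
vacuum. -/
theorem exists_smul_of_singular {ψ : Heis →ₗ[ℂ] V} (hi : Function.Injective ψ)
    (hψ : ∀ n x, ψ (heisMode α n x) = ncoeff J n (ψ x)) {u : V} (hu : u ∈ LinearMap.range ψ)
    (hpos : ∀ m : ℤ, 0 < m → ncoeff J m u = 0) : ∃ r : ℂ, u = r • ψ 1 := by
  obtain ⟨p, rfl⟩ := hu
  have hC := eq_C_of_pderiv_eq_zero (p := p) fun k => by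
    have := hψ (k + 1) p
    rw [hpos _ (by lia), heisMode_natCast_add_one, map_smul] at this
    have := (smul_eq_zero.1 this).resolve_left (Nat.cast_add_one_ne_zero k)
    exact hi (this.trans (map_zero ψ).symm)
  rw [← mul_one (MvPolynomial.C _), ← MvPolynomial.smul_eq_C_mul] at hC
  exact ⟨p.coeff 0, by rw [hC, map_smul]; simp⟩

end HighestWeight

/-! ### Decomposition into charge sectors -/

section Correspondence

variable {V : Type*} [AddCommGroup V] [Module ℂ V] {β γ : VertexOperator ℂ V} {Ω : V}

/-- Decompose `x ∈ p i` along the spanning family `q`: the part outside `q i` lies in `p i` and in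
the span of the other `p k`, so it is zero. -/
theorem iSupIndep_eq_of_le {ι M : Type*} [AddCommGroup M] [Module ℂ M] {p q : ι → Submodule ℂ M}
    (hp : iSupIndep p) (hqp : q ≤ p) (hq : ⨆ i, q i = ⊤) : q = p := by
  funext i
  refine (hqp i).antisymm fun x hx => ?_
  have hx' : x ∈ q i ⊔ ⨆ (k) (_ : k ≠ i), q k := by
    have : (⊤ : Submodule ℂ M) ≤ q i ⊔ ⨆ (k) (_ : k ≠ i), q k := by
      rw [← hq]
      refine iSup_le fun k => ?_
      by_cases h : k = i
      · rw [h]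
        exact le_sup_left
      · exact (le_iSup₂ (f := fun k (_ : k ≠ i) => q k) k h).trans le_sup_right
    exact this trivial
  obtain ⟨y, hy, z, hz, rfl⟩ := Submodule.mem_sup.1 hx'
  have hz1 : z ∈ p i := by
    have := sub_mem hx (hqp i hy)
    rwa [add_sub_cancel_left] at this
  have hz2 : z ∈ ⨆ (k) (_ : k ≠ i), p k := (iSup₂_mono fun k _ => hqp k) hz
  rw [(Submodule.disjoint_def.1 (hp i)) z hz1 hz2, add_zero]
  exact hy

namespace IsFermionFock

variable (H : IsFermionFock β γ Ω)
include H

theorem b_chargedVacuum_mem {l : ℤ} {S : Submodule ℂ V}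
    (hS : ∀ m : ℤ, m < 0 → ∀ v ∈ S, ncoeff (current β γ) m v ∈ S)
    (hv : chargedVacuum β γ Ω (l + 1) ∈ S) (n : ℤ) :
    ncoeff β n (chargedVacuum β γ Ω l) ∈ S := by
  obtain ⟨d, hd⟩ : ∃ d : ℕ, -l - n ≤ d := ⟨(-l - n).toNat, by lia⟩
  induction d using Nat.strong_induction_on generalizing n with
  | _ d ih =>
    rcases lt_trichotomy n (-l - 1) with h | rfl | h
    · have h1 := hasLocSum_normalTerm 1 (current β γ) β (n + 1) (chargedVacuum β γ Ω l)
      rw [H.normalMode_current_b] at h1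
      -- Adding `-l β_n v_l` cancels the `i = 0` term. What remains are the terms with `i < 0`, in
      -- `S` by induction since they involve `β_{n-i}` with larger index; the resulting coefficient
      -- `-n - 1 - l` is nonzero for `n < -l - 1`.
      have h2 := (h1.add ((hasFinSum_single (0 : ℤ)
        ((-(l : ℂ)) • ncoeff β n (chargedVacuum β γ Ω l))))).mem S fun i => ?_
      · rw [add_sub_cancel_right, LinearMap.smul_apply, ← add_smul] at h2
        refine (S.smul_mem_iff ?_).1 h2
        have : -((n + 1 : ℤ) : ℂ) + -(l : ℂ) = ((-n - 1 - l : ℤ) : ℂ) := by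
          push_cast
          ring
        rw [this]
        exact Int.cast_ne_zero.2 (by lia)
      · simp only [normalTerm, Units.val_one, Int.cast_one, one_smul]
        rcases lt_trichotomy i 0 with hi | rfl | hi
        · rw [if_pos hi, if_neg hi.ne, add_zero]
          refine hS i hi _ (ih (d - 1) (by lia) _ (by lia))
        · rw [if_neg (lt_irrefl _), if_pos rfl, Module.End.mul_apply,
            H.current_zero_chargedVacuum, map_smul, show n + 1 - 0 - 1 = n by ring, ← add_smul,
            add_neg_cancel, zero_smul]
          exact zero_mem S
        · rw [if_neg hi.not_gt, if_neg hi.ne', add_zero, Module.End.mul_apply,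
            H.current_chargedVacuum_eq_zero hi, map_zero]
          exact zero_mem S
    · rwa [← H.chargedVacuum_add_one]
    · rw [H.b_chargedVacuum_eq_zero (by lia)]
      exact zero_mem S

theorem c_chargedVacuum_mem {l : ℤ} {S : Submodule ℂ V}
    (hS : ∀ m : ℤ, m < 0 → ∀ v ∈ S, ncoeff (current β γ) m v ∈ S)
    (hv : chargedVacuum β γ Ω l ∈ S) (n : ℤ) :
    ncoeff γ n (chargedVacuum β γ Ω (l + 1)) ∈ S := by
  obtain ⟨d, hd⟩ : ∃ d : ℕ, l + 1 - n ≤ d := ⟨(l + 1 - n).toNat, by lia⟩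
  induction d using Nat.strong_induction_on generalizing n with
  | _ d ih =>
    rcases lt_trichotomy n l with h | rfl | h
    · have h1 := hasLocSum_normalTerm 1 (current β γ) γ (n + 1) (chargedVacuum β γ Ω (l + 1))
      rw [H.normalMode_current_c] at h1
      have h2 := (h1.add ((hasFinSum_single (0 : ℤ)
        ((-((l + 1 : ℤ) : ℂ)) • ncoeff γ n (chargedVacuum β γ Ω (l + 1)))))).mem S fun i => ?_
      · rw [add_sub_cancel_right, LinearMap.smul_apply, ← add_smul] at h2
        refine (S.smul_mem_iff ?_).1 h2
        have : ((n + 1 : ℤ) : ℂ) + -((l + 1 : ℤ) : ℂ) = ((n - l : ℤ) : ℂ) := by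
          push_cast
          ring
        rw [this]
        exact Int.cast_ne_zero.2 (by lia)
      · simp only [normalTerm, Units.val_one, Int.cast_one, one_smul]
        rcases lt_trichotomy i 0 with hi | rfl | hi
        · rw [if_pos hi, if_neg hi.ne, add_zero]
          refine hS i hi _ (ih (d - 1) (by lia) _ (by lia))
        · rw [if_neg (lt_irrefl _), if_pos rfl, Module.End.mul_apply,
            H.current_zero_chargedVacuum, map_smul, show n + 1 - 0 - 1 = n by ring, ← add_smul,
            add_neg_cancel, zero_smul]
          exact zero_mem S
        · rw [if_neg hi.not_gt, if_neg hi.ne', add_zero, Module.End.mul_apply,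
            H.current_chargedVacuum_eq_zero hi, map_zero]
          exact zero_mem S
    · rwa [H.c_chargedVacuum_add_one]
    · rw [H.c_chargedVacuum_eq_zero (by lia)]
      exact zero_mem S

/-- The charged vacua generate the whole space under the creation modes of the current. -/
theorem iSup_eq_top_of_stable {S : ℤ → Submodule ℂ V}
    (hvac : ∀ l, chargedVacuum β γ Ω l ∈ S l)
    (hS : ∀ l (m : ℤ), m < 0 → ∀ v ∈ S l, ncoeff (current β γ) m v ∈ S l)
    (hind : ∀ l (R : Submodule ℂ V), chargedVacuum β γ Ω l ∈ R →
      (∀ m : ℤ, m < 0 → ∀ v ∈ R, ncoeff (current β γ) m v ∈ R) → S l ≤ R) :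
    ⨆ l, S l = ⊤ := by
  refine H.submodule_eq_top (Submodule.mem_iSup_of_mem 0 (hvac 0)) (fun n v hv => ?_)
    fun n v hv => ?_
  · have hb : ∀ l, S l ≤ ⨅ k, (S (l + 1)).comap (ncoeff β k) := fun l => by
      refine hind l _ ?_ fun m hm v hv => ?_
      · rw [Submodule.mem_iInf]
        exact fun k => H.b_chargedVacuum_mem (hS (l + 1)) (hvac (l + 1)) k
      · rw [Submodule.mem_iInf] at hv ⊢
        intro k
        have h := LinearMap.congr_fun (H.current_mul_b m k) v
        simp only [Module.End.mul_apply, LinearMap.add_apply] at h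
        rw [Submodule.mem_comap, ← sub_eq_iff_eq_add.2 h]
        exact sub_mem (hS _ m hm _ (hv k)) (hv (k + m))
    have hle : ⨆ l, S l ≤ (⨆ l, S l).comap (ncoeff β n) :=
      iSup_le fun l => (hb l).trans ((iInf_le _ n).trans
        (Submodule.comap_mono (le_iSup S (l + 1))))
    exact hle hv
  · have hc : ∀ l, S l ≤ ⨅ k, (S (l - 1)).comap (ncoeff γ k) := fun l => by
      refine hind l _ ?_ fun m hm v hv => ?_
      · rw [Submodule.mem_iInf]
        intro k
        have := H.c_chargedVacuum_mem (hS (l - 1)) (hvac (l - 1)) k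
        rwa [sub_add_cancel] at this
      · rw [Submodule.mem_iInf] at hv ⊢
        intro k
        have h := LinearMap.congr_fun (H.current_mul_c m k) v
        simp only [Module.End.mul_apply, LinearMap.sub_apply] at h
        rw [Submodule.mem_comap, sub_eq_iff_eq_add.1 h.symm]
        exact add_mem (hS _ m hm _ (hv k)) (hv (k + m))
    have hle : ⨆ l, S l ≤ (⨆ l, S l).comap (ncoeff γ n) :=
      iSup_le fun l => (hc l).trans ((iInf_le _ n).trans
        (Submodule.comap_mono (le_iSup S (l - 1))))
    exact hle hv

/-- The boson-fermion correspondence. -/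
theorem exists_bosonFermion : ∃ ψ : ℤ → Heis →ₗ[ℂ] V,
    (∀ l, ψ l 1 = chargedVacuum β γ Ω l) ∧
    (∀ l n x, ψ l (heisMode l n x) = ncoeff (current β γ) n (ψ l x)) ∧
    (∀ l, Function.Injective (ψ l)) ∧
    (∀ l : ℤ, LinearMap.range (ψ l) = Module.End.eigenspace (ncoeff (current β γ) 0) (l : ℂ)) ∧
    ⨆ l, LinearMap.range (ψ l) = ⊤ := by
  choose ψ h1 hψ using fun l : ℤ => H.isHeisenberg_current.exists_intertwiner
    (H.current_zero_chargedVacuum l) (fun m hm => H.current_chargedVacuum_eq_zero hm l)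
  have htop : ⨆ l, LinearMap.range (ψ l) = ⊤ := by
    refine H.iSup_eq_top_of_stable (fun l => ⟨1, h1 l⟩) ?_ fun l R hR hst => ?_
    · rintro l m - _ ⟨x, rfl⟩
      exact ⟨_, hψ l m x⟩
    · rintro _ ⟨x, rfl⟩
      induction x using MvPolynomial.induction_on with
      | C a =>
        rw [← mul_one (MvPolynomial.C a), ← MvPolynomial.smul_eq_C_mul, map_smul, h1]
        exact R.smul_mem a hR
      | add p q hp hq =>
        rw [map_add]
        exact add_mem hp hq
      | mul_X p i hp =>
        rw [mul_comm, ← heisMode_negSucc l, hψ]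
        exact hst _ (by lia) _ hp
  refine ⟨ψ, h1, hψ, fun l => injective_of_intertwines (by
    rw [h1]
    exact H.chargedVacuum_ne_zero l) (hψ l), fun l => ?_, htop⟩
  have hind : iSupIndep fun l : ℤ =>
      Module.End.eigenspace (ncoeff (current β γ) 0) (l : ℂ) :=
    (Module.End.eigenspaces_iSupIndep _).comp Int.cast_injective
  refine congrFun (iSupIndep_eq_of_le hind (fun l => ?_) htop) l
  rintro _ ⟨x, rfl⟩
  rw [Module.End.mem_eigenspace_iff, ← hψ, heisMode_zero, map_smul]

/-! ### Comparison of the bosonic and the fermionic fields -/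

/-- A family of homogeneous operators commuting with the current vanishes as soon as the operator of
degree zero kills the charged vacua. -/
theorem eq_zero_of_comm_current {D : ℤ → Module.End ℂ V} {k : ℤ}
    (hD : ∀ m n, ncoeff (current β γ) m * D n = D n * ncoeff (current β γ) m)
    (hL : ∀ n : ℤ, ncoeff (fermionStress β γ) 1 * D n - D n * ncoeff (fermionStress β γ) 1 =
      (k - n : ℂ) • D n)
    (h0 : ∀ l, D k (chargedVacuum β γ Ω l) = 0) (n : ℤ) : D n = 0 := by
  obtain ⟨ψ, h1, hψ, hinj, hrange, htop⟩ := H.exists_bosonFermion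
  have hD' : ∀ m v, ncoeff (current β γ) m (D n v) = D n (ncoeff (current β γ) m v) :=
    fun m v => LinearMap.congr_fun (hD m n) v
  have hvac : ∀ l, D n (chargedVacuum β γ Ω l) = 0 := fun l => by
    by_cases hn : n = k
    · rw [hn, h0]
    -- `D n` commutes with the current, so it preserves the charge and the highest weight
    -- conditions.
    obtain ⟨r, hr⟩ := exists_smul_of_singular (hinj l) (hψ l)
      (u := D n (chargedVacuum β γ Ω l)) (by
        rw [hrange, Module.End.mem_eigenspace_iff, hD', H.current_zero_chargedVacuum, map_smul])
      (fun m hm => by rw [hD', H.current_chargedVacuum_eq_zero hm, map_zero])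
    -- A multiple of the vacuum has the same `T_1`-eigenvalue as the vacuum, whereas `D n` shifts it
    -- by `k - n ≠ 0`.
    have h2 := LinearMap.congr_fun (hL n) (chargedVacuum β γ Ω l)
    simp only [LinearMap.sub_apply, Module.End.mul_apply, LinearMap.smul_apply] at h2
    rw [H.fermionStress_chargedVacuum, map_smul, hr, h1, map_smul, H.fermionStress_chargedVacuum,
      smul_comm r, sub_self] at h2
    rw [hr, h1]
    refine (smul_eq_zero.1 h2.symm).resolve_left ?_
    rw [← Int.cast_sub]
    exact Int.cast_ne_zero.2 (by lia)
  refine LinearMap.ker_eq_top.1 (eq_top_iff.2 (htop ▸ iSup_le fun l => ?_))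
  rintro _ ⟨x, rfl⟩
  rw [LinearMap.mem_ker]
  induction x using MvPolynomial.induction_on with
  | C a =>
    rw [← mul_one (MvPolynomial.C a), ← MvPolynomial.smul_eq_C_mul, map_smul, h1, map_smul, hvac,
      smul_zero]
  | add p q hp hq => rw [map_add, map_add, hp, hq, add_zero]
  | mul_X p i hp => rw [mul_comm, ← heisMode_negSucc l, hψ, ← hD', hp, map_zero]

/-- Only `i = 0` survives on a charged vacuum: for `i > 0` the current kills it, and for `i < 0` the
mode of `B` has index at least `n`. -/
theorem normalMode_current_chargedVacuum {B : VertexOperator ℂ V} {n : ℤ} {l : ℤ} {r : ℂ}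
    (hB : ∀ k : ℤ, n ≤ k → ncoeff B k (chargedVacuum β γ Ω l) = 0)
    (hr : ncoeff B (n - 1) (chargedVacuum β γ Ω l) = r • chargedVacuum β γ Ω l) :
    normalMode 1 (current β γ) B n (chargedVacuum β γ Ω l) =
      (l * r) • chargedVacuum β γ Ω l := by
  refine (hasLocSum_normalTerm 1 (current β γ) B n (chargedVacuum β γ Ω l)).unique ?_
  convert hasFinSum_single (0 : ℤ) ((l * r) • chargedVacuum β γ Ω l) using 2 with i
  simp only [normalTerm, Units.val_one, Int.cast_one, one_smul]
  rcases lt_trichotomy i 0 with hi | rfl | hi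
  · rw [if_pos hi, if_neg hi.ne, Module.End.mul_apply, hB _ (by lia), map_zero]
  · rw [if_neg (lt_irrefl _), if_pos rfl, Module.End.mul_apply, H.current_zero_chargedVacuum,
      map_smul, sub_zero, hr, smul_smul]
  · rw [if_neg hi.not_gt, if_neg hi.ne', Module.End.mul_apply, H.current_chargedVacuum_eq_zero hi,
      map_zero]

theorem sq_chargedVacuum (l : ℤ) : ncoeff (nopEven (current β γ) (current β γ)) 1
    (chargedVacuum β γ Ω l) = (l * l : ℂ) • chargedVacuum β γ Ω l := by
  rw [ncoeff_normalOrder]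
  exact H.normalMode_current_chargedVacuum
    (fun k hk => H.current_chargedVacuum_eq_zero (by lia) l) (H.current_zero_chargedVacuum l)

theorem sq_chargedVacuum_eq_zero {n : ℤ} (hn : 2 ≤ n) (l : ℤ) :
    ncoeff (nopEven (current β γ) (current β γ)) n (chargedVacuum β γ Ω l) = 0 := by
  rw [ncoeff_normalOrder, H.normalMode_current_chargedVacuum (r := 0)
    (fun k hk => H.current_chargedVacuum_eq_zero (by lia) l)
    (by rw [H.current_chargedVacuum_eq_zero (by lia) l, zero_smul]), mul_zero, zero_smul]

theorem deriv_chargedVacuum (l : ℤ) : ncoeff (fieldDeriv (current β γ)) 1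
    (chargedVacuum β γ Ω l) = (-l : ℂ) • chargedVacuum β γ Ω l := by
  rw [ncoeff_fieldDeriv, LinearMap.smul_apply, sub_self, H.current_zero_chargedVacuum, smul_smul]
  congr 1
  simp

theorem deriv_chargedVacuum_eq_zero {n : ℤ} (hn : 2 ≤ n) (l : ℤ) :
    ncoeff (fieldDeriv (current β γ)) n (chargedVacuum β γ Ω l) = 0 := by
  rw [ncoeff_fieldDeriv, LinearMap.smul_apply, H.current_chargedVacuum_eq_zero (by lia), smul_zero]

theorem comm_fermionStress_one_b (n : ℤ) :
    ncoeff (fermionStress β γ) 1 * ncoeff β n - ncoeff β n * ncoeff (fermionStress β γ) 1 =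
      (-1 - n : ℂ) • ncoeff β n := by
  rw [ncoeff_fermionStress, H.comm_bilin_b, show (1 : ℤ) - 2 + n + 1 = n by ring]
  congr 1
  ring

theorem comm_fermionStress_one_c (n : ℤ) :
    ncoeff (fermionStress β γ) 1 * ncoeff γ n - ncoeff γ n * ncoeff (fermionStress β γ) 1 =
      (0 - n : ℂ) • ncoeff γ n := by
  rw [ncoeff_fermionStress, H.comm_bilin_c, show (1 : ℤ) - 2 + n + 1 = n by ring, ← neg_smul]
  congr 1
  push_cast
  ring

theorem comm_fermionStress_one_current (n : ℤ) :
    ncoeff (fermionStress β γ) 1 * ncoeff (current β γ) n -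
      ncoeff (current β γ) n * ncoeff (fermionStress β γ) 1 =
      (0 - n : ℂ) • ncoeff (current β γ) n := by
  have h := comm_normalMode_of_homogeneous _ (-1) H.comm_fermionStress_one_b
    H.comm_fermionStress_one_c n
  rw [current, ncoeff_normalOrder, h]
  congr 1
  ring

theorem comm_fermionStress_one_fermionStress (n : ℤ) :
    ncoeff (fermionStress β γ) 1 * ncoeff (fermionStress β γ) n -
      ncoeff (fermionStress β γ) n * ncoeff (fermionStress β γ) 1 =
      (1 - n : ℂ) • ncoeff (fermionStress β γ) n := by
  have h := comm_normalMode_of_homogeneous _ (-1)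
    (comm_fieldDeriv_of_homogeneous _ H.comm_fermionStress_one_b) H.comm_fermionStress_one_c n
  rw [← ncoeff_normalOrder] at h
  refine h.trans ?_
  congr 1
  ring

theorem comm_fermionStress_one_fermionCubic (n : ℤ) :
    ncoeff (fermionStress β γ) 1 * ncoeff (fermionCubic β γ) n -
      ncoeff (fermionCubic β γ) n * ncoeff (fermionStress β γ) 1 =
      (2 - n : ℂ) • ncoeff (fermionCubic β γ) n := by
  have hb := comm_fieldDeriv_of_homogeneous _ H.comm_fermionStress_one_b
  have h1 := comm_normalMode_of_homogeneous _ (-1) (comm_fieldDeriv_of_homogeneous _ hb)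
    H.comm_fermionStress_one_c n
  have h2 := comm_normalMode_of_homogeneous _ (-1) hb
    (comm_fieldDeriv_of_homogeneous _ H.comm_fermionStress_one_c) n
  simp only [fermionCubic, map_smul, map_sub, Pi.smul_apply, Pi.sub_apply, ncoeff_normalOrder]
  rw [mul_smul_comm, smul_mul_assoc, ← smul_sub, mul_sub, sub_mul, sub_sub_sub_comm, h1, h2]
  module

theorem fermionStress_eq : fermionStress β γ = bosonStress (current β γ) := by
  refine field_ext fun n => sub_eq_zero.1 (H.eq_zero_of_comm_current
    (D := fun n => ncoeff (fermionStress β γ) n - ncoeff (bosonStress (current β γ)) n) (k := 1)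
    (fun m n => ?_) (fun n => ?_) (fun l => ?_) n)
  · have h1 := H.comm_current_fermionStress m n
    rw [← H.isHeisenberg_current.comm_bosonStress, sub_eq_sub_iff_sub_eq_sub] at h1
    rw [mul_sub, sub_mul, h1]
  · have h1 := H.comm_fermionStress_one_fermionStress n
    have h2 := comm_bosonStress_of_homogeneous _ H.comm_fermionStress_one_current n
    rw [mul_sub, sub_mul, sub_sub_sub_comm, h1, h2, Int.cast_one, smul_sub]
  · rw [LinearMap.sub_apply, H.fermionStress_chargedVacuum, ncoeff_bosonStress,
      LinearMap.smul_apply, LinearMap.add_apply, H.sq_chargedVacuum, H.deriv_chargedVacuum]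
    module

/-- The commutators with the current agree only once the stress fields are identified, so
`fermionStress_eq` has to come first. -/
theorem fermionCubic_eq : fermionCubic β γ = bosonCubic (current β γ) := by
  refine field_ext fun n => sub_eq_zero.1 (H.eq_zero_of_comm_current
    (D := fun n => ncoeff (fermionCubic β γ) n - ncoeff (bosonCubic (current β γ)) n) (k := 2)
    (fun m n => ?_) (fun n => ?_) (fun l => ?_) n)
  · have h1 := H.comm_current_fermionCubic m n
    rw [H.fermionStress_eq, ← H.isHeisenberg_current.comm_bosonCubic,
      sub_eq_sub_iff_sub_eq_sub] at h1
    rw [mul_sub, sub_mul, h1]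
  · have h1 := H.comm_fermionStress_one_fermionCubic n
    have h2 := comm_bosonCubic_of_homogeneous _ H.comm_fermionStress_one_current n
    rw [mul_sub, sub_mul, sub_sub_sub_comm, h1, h2, smul_sub]
    push_cast
    rfl
  -- On the vacuum of charge `l` the three bosonic terms give `l³`, `-l²` and `2l`, and `(4l³ - 6l²
  -- + 2l)/12` is the fermionic value `l(l-1)(2l-1)/6`.
  · have h1 := H.normalMode_current_chargedVacuum (n := 2)
      (fun k hk => H.sq_chargedVacuum_eq_zero hk l) (H.sq_chargedVacuum l)
    have h2 := H.normalMode_current_chargedVacuum (n := 2)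
      (fun k hk => H.deriv_chargedVacuum_eq_zero hk l) (H.deriv_chargedVacuum l)
    have h3 : ncoeff (fieldDeriv (fieldDeriv (current β γ))) 2 (chargedVacuum β γ Ω l) =
        (2 * l : ℂ) • chargedVacuum β γ Ω l := by
      rw [ncoeff_fieldDeriv, LinearMap.smul_apply, show (2 : ℤ) - 1 = 1 by ring,
        H.deriv_chargedVacuum, smul_smul]
      congr 1
      push_cast
      ring
    rw [LinearMap.sub_apply, H.fermionCubic_chargedVacuum, ncoeff_bosonCubic,
      LinearMap.smul_apply, LinearMap.add_apply, LinearMap.add_apply, LinearMap.smul_apply,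
      LinearMap.smul_apply, ncoeff_normalOrder, ncoeff_normalOrder, h1, h2, h3]
    module

end IsFermionFock

/-! ### Transport of the bosonic fields along intertwiners -/

section Transport

variable {W : Type*} [AddCommGroup W] [Module ℂ W] (φ : V →ₗ[ℂ] W)
  {J : VertexOperator ℂ V} {K : VertexOperator ℂ W}

theorem fieldDeriv_intertwine {A : VertexOperator ℂ V} {B : VertexOperator ℂ W}
    (h : ∀ n x, φ (ncoeff A n x) = ncoeff B n (φ x)) (n : ℤ) (x : V) :
    φ (ncoeff (fieldDeriv A) n x) = ncoeff (fieldDeriv B) n (φ x) := by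
  simp only [ncoeff_fieldDeriv, LinearMap.smul_apply, map_smul, h]

theorem nopEven_intertwine {A B : VertexOperator ℂ V} {A' B' : VertexOperator ℂ W}
    (hA : ∀ n x, φ (ncoeff A n x) = ncoeff A' n (φ x))
    (hB : ∀ n x, φ (ncoeff B n x) = ncoeff B' n (φ x)) (n : ℤ) (x : V) :
    φ (ncoeff (nopEven A B) n x) = ncoeff (nopEven A' B') n (φ x) := by
  simp only [ncoeff_normalOrder]
  exact normalMode_intertwine φ 1 hA hB n x

theorem bosonStress_intertwine (h : ∀ n x, φ (ncoeff J n x) = ncoeff K n (φ x)) (n : ℤ) (x : V) :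
    φ (ncoeff (bosonStress J) n x) = ncoeff (bosonStress K) n (φ x) := by
  simp only [ncoeff_bosonStress, LinearMap.smul_apply, LinearMap.add_apply, map_smul, map_add,
    nopEven_intertwine φ h h, fieldDeriv_intertwine φ h]

theorem bosonCubic_intertwine (h : ∀ n x, φ (ncoeff J n x) = ncoeff K n (φ x)) (n : ℤ) (x : V) :
    φ (ncoeff (bosonCubic J) n x) = ncoeff (bosonCubic K) n (φ x) := by
  simp only [ncoeff_bosonCubic, LinearMap.smul_apply, LinearMap.add_apply, map_smul, map_add,
    nopEven_intertwine φ h (nopEven_intertwine φ h h),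
    nopEven_intertwine φ h (fieldDeriv_intertwine φ h),
    fieldDeriv_intertwine φ (fieldDeriv_intertwine φ h)]

end Transport

end Correspondence

theorem exists_isBosonFermionCorrespondence (l : ℤ) :
    ∃ Φ : Heis ≃ₗ[ℂ] charge l, IsBosonFermionCorrespondence l Φ := by
  obtain ⟨ψ, -, hψ, hinj, hrange, -⟩ := isFermionFock_b_c.exists_bosonFermion
  refine ⟨(LinearEquiv.ofInjective (ψ l) (hinj l)).trans (LinearEquiv.ofEq _ _ (hrange l)),
    fun n x => ?_⟩
  rw [jH, ncoeff_ofModes]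
  exact hψ l n x

end BosonFermion

end

open VertexOperator BosonFermion in
theorem mainTheorem6 :
    (T = (1 / 2 : ℂ) • (nopEven j j + fieldDeriv j) ∧
      Wtilde = (1 / 12 : ℂ) • ((4 : ℂ) • nopEven j (nopEven j j) +
        (6 : ℂ) • nopEven j (fieldDeriv j) + fieldDeriv (fieldDeriv j))) ∧
    ∀ l : ℤ,
      (∃ Φ : Heis ≃ₗ[ℂ] charge l, IsBosonFermionCorrespondence l Φ) ∧
      ∀ Φ : Heis ≃ₗ[ℂ] charge l, IsBosonFermionCorrespondence l Φ →
        ∀ (n : ℤ) (x : Heis),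
          ncoeff T n (Φ x : Fock) =
            (Φ (ncoeff ((1 / 2 : ℂ) • (nopEven (jH l) (jH l) + fieldDeriv (jH l))) n x) : Fock) ∧
          ncoeff Wtilde n (Φ x : Fock) =
            (Φ (ncoeff ((1 / 12 : ℂ) • ((4 : ℂ) • nopEven (jH l) (nopEven (jH l) (jH l)) +
              (6 : ℂ) • nopEven (jH l) (fieldDeriv (jH l)) + fieldDeriv (fieldDeriv (jH l)))) n x) : Fock) := by
  have hT : T = bosonStress j := isFermionFock_b_c.fermionStress_eq
  have hW : Wtilde = bosonCubic j := isFermionFock_b_c.fermionCubic_eq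
  refine ⟨⟨hT, hW⟩, fun l => ⟨exists_isBosonFermionCorrespondence l, fun Φ hΦ n x => ?_⟩⟩
  rw [hT, hW]
  -- `Φ` is composed with the inclusion of the charge sector, giving a map into the full Fock space,
  -- where the fields act.
  exact ⟨(bosonStress_intertwine ((charge l).subtype ∘ₗ Φ.toLinearMap) hΦ n x).symm,
    (bosonCubic_intertwine ((charge l).subtype ∘ₗ Φ.toLinearMap) hΦ n x).symm⟩
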